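/- Let $\bar M$ be a monster model of a complete first-order theory $T$ in a language $L$: for some cardinal $\kappa>\aleph_0+|L|$, $\bar M$ is $\kappa$-saturated and strongly $\kappa$-homogeneous; "small" means of cardinality $<\kappa$. Global types are complete types over $\bar M$ in finitely many variables; their realizations are taken in elementary extensions of $\bar M$. A global type is non-algebraic if each of its formulas has infinitely many solutions in $\bar M$. A global type $\mathfrak p(x)$ ($x$ a finite tuple of variables) is $A$-invariant if $\varphi(x,b)\in\mathfrak p\iff\varphi(x,b')\in\mathfrak p$ whenever $b\equiv b'\,(A)$, and invariant if this holds for some small $A$; then $\mathfrak p_{\upharpoonright \bar M b}$ is defined, for $b$ in an elementary extension of $\bar M$, by: $\varphi(x,c)\in\mathfrak p_{\upharpoonright\bar M b}$ iff $\varphi(x,c')\in\mathfrak p$ for some (equivalently, all) $c'$ in $\bar M$ with $c'\equiv c\,(A)$. A non-algebraic $\mathfrak p$ is *generically stable* if for some small $A$ it is $A$-invariant and for every infinite ordinal $\alpha$, every sequence $(a_i)_{i<\alpha}$ in $\bar M$ with $a_i\models\mathfrak p_{\upharpoonright A a_{<i}}$ for all $i<\alpha$, and every formula $\varphi(x)$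 over $\bar M$, the set $\{i:\models\varphi(a_i)\}$ is finite or co-finite. A non-algebraic $\mathfrak p$ is *strongly regular* if for some formula $\phi(x)\in\mathfrak p$ and some small $A$ containing the parameters of $\phi$, $\mathfrak p$ is $A$-invariant and for all small $B\supseteq A$ and all $a$ in $\bar M$ satisfying $\phi$: either $a\models\mathfrak p_{\upharpoonright B}$ or $\mathfrak p_{\upharpoonright B}\vdash\mathfrak p_{\upharpoonright Ba}$. Global types $\mathfrak p(x),\mathfrak q(y)$ are *orthogonal*, $\mathfrak p\perp\mathfrak q$, if $\mathfrak p(x)\cup\mathfrak q(y)$ determines a complete type over $\bar M$. Write $a\in\mathrm{Sem}_{\bar M}(b)$ if some formula $\varphi(x,b)\in\mathrm{tp}(a/\bar M b)$ implies $\mathrm{tp}(a/\bar M)$. Write $\mathfrak p\le_{RK}\mathfrak q$ if there are $a\models\mathfrak p$ and $b\models\mathfrak q$ with $a\in\mathrm{Sem}_{\bar M}(b)$; $\mathfrak p$ and $\mathfrak q$ are *strongly RK-equivalent* if there are $a\models\mathfrak p$ and $b\models\mathfrak q$ with both $a\in\mathrm{Sem}_{\bar M}(b)$ and $b\in\mathrm{Sem}_{\bar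 M}(a)$. **Theorem.** Let $\mathfrak p$ be a generically stable, strongly regular global type. (1) $\mathfrak p$ is minimal in the quasi-order $\le_{RK}$ on non-algebraic global types: if $\mathfrak q$ is a non-algebraic global type and $\mathfrak q\le_{RK}\mathfrak p$, then $\mathfrak p\le_{RK}\mathfrak q$. (2) For every global type $\mathfrak q$ (in particular, for every invariant one): $\mathfrak p\not\perp\mathfrak q$ if and only if $\mathfrak p\le_{RK}\mathfrak q$. (3) Let $\mathfrak q$ also be a generically stable, strongly regular global type. If $\mathfrak p\not\perp\mathfrak q$, then $\mathfrak p$ and $\mathfrak q$ are strongly RK-equivalent. Moreover, whenever $a\models\mathfrak p$ and $b\models\mathfrak q$ lie in an elementary extension of $\bar M$ and $a\not\models\mathfrak p_{\upharpoonright\bar M b}$, then $b\not\models\mathfrak q_{\upharpoonright\bar M a}$, $b\in\mathrm{Sem}_{\bar M}(a)$ and $a\in\mathrm{Sem}_{\bar M}(b)$. -/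

import Mathlib

open FirstOrder Cardinal

universe u

namespace GlobalRK

open FirstOrder.Language

section

variable {L : FirstOrder.Language.{u, u}} {M : Type u} [L.Structure M]

variable (L M) in
/-- `M` is a monster model, smallness meaning cardinality `< κ`: `κ` is larger than `ℵ₀` and than
the language, `M` is `κ`-saturated and strongly `κ`-homogeneous. -/
structure IsMonster (κ : Cardinal.{u}) : Prop where
  aleph0_lt : ℵ₀ < κ
  card_lt : L.card < κ
  /-- Every set of formulas over a small `A`, in finitely many variables, that is finitely
  satisfiable in `M` is realized in `M`. A formula over `A` is an `L`-formula some of whose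
  variables are named by the elements of `A`. -/
  saturated : ∀ A : Set M, #A < κ → ∀ (n : ℕ) (Γ : Set (L.Formula (Fin n ⊕ A))),
    (∀ Γ₀ ⊆ Γ, Γ₀.Finite →
      ∃ a : Fin n → M, ∀ φ ∈ Γ₀, φ.Realize (Sum.elim a Subtype.val)) →
    ∃ a : Fin n → M, ∀ φ ∈ Γ, φ.Realize (Sum.elim a Subtype.val)
  /-- Every elementary map from a small subset of `M` into `M` extends to an automorphism. -/
  homogeneous : ∀ A : Set M, #A < κ → ∀ f : A → M,
    (∀ φ : L.Formula A, φ.Realize (Subtype.val : A → M) ↔ φ.Realize f) →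
    ∃ σ : M ≃[L] M, ∀ a : A, σ a = f a

variable (L M) in
/-- Complete types over the whole of `M` in the variables `(x_i)_{i ∈ α}`. -/
abbrev GlobalType (α : Type) := (L.elementaryDiagram M).CompleteType α

variable {α β : Type}

/-- The formula `φ(x, c)` with parameters from `M`, for an `L`-formula `φ(x, z)` and a
tuple `c` of elements of `M`. -/
def plug {k : ℕ} (φ : L.Formula (α ⊕ Fin k)) (c : Fin k → M) : L[[M]].Formula α :=
  BoundedFormula.constantsVarsEquiv.symm
    (Formula.relabel (Sum.elim Sum.inr (Sum.inl ∘ c) : α ⊕ Fin k → M ⊕ α) φ)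

/-- `φ(x, c) ∈ p`. -/
def Has (p : GlobalType L M α) {k : ℕ} (φ : L.Formula (α ⊕ Fin k)) (c : Fin k → M) : Prop :=
  Formula.equivSentence (plug φ c) ∈ p

/-- `p` contains no formula with finitely many solutions in `M`. -/
def NonAlgebraic (p : GlobalType L M α) : Prop :=
  ∀ (k : ℕ) (φ : L.Formula (α ⊕ Fin k)) (c : Fin k → M),
    Has p φ c → {a : α → M | φ.Realize (Sum.elim a c)}.Infinite

/-! ### Elementary extensions `j : M ↪ₑ[L] N` and types of tuples of `N` -/

section Extension

variable {N : Type u} [L.Structure N] (j : M ↪ₑ[L] N)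

/-- `tp(b / A) = tp(b' / A)`, for tuples `b`, `b'` of `N` and a set `A` of parameters from `M`. -/
def SameType (A : Set M) (b b' : β → N) : Prop :=
  ∀ (k : ℕ) (ψ : L.Formula (β ⊕ Fin k)) (d : Fin k → M), (∀ i, d i ∈ A) →
    (ψ.Realize (Sum.elim b (j ∘ d)) ↔ ψ.Realize (Sum.elim b' (j ∘ d)))

/-- `a ⊨ p`, for a tuple `a` of `N`. -/
def Realizes (p : GlobalType L M α) (a : α → N) : Prop :=
  ∀ (k : ℕ) (φ : L.Formula (α ⊕ Fin k)) (c : Fin k → M),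
    Has p φ c ↔ φ.Realize (Sum.elim a (j ∘ c))

/-- `a ∈ Sem_M(b)`, that is `b` semi-isolates `a` over `M`: some formula `φ(x, b)` over `M b`
is satisfied by `a` and implies `tp(a / M)`. (The implication holds in `N` if and only if it holds
in all elementary extensions of `N`, because it can be checked for each formula of `tp(a / M)`
separately.) -/
def SemiIsolatedBy (a : α → N) (b : β → N) : Prop :=
  ∃ (k : ℕ) (φ : L.Formula ((α ⊕ β) ⊕ Fin k)) (d : Fin k → M),
    φ.Realize (Sum.elim (Sum.elim a b) (j ∘ d)) ∧
    ∀ a' : α → N, φ.Realize (Sum.elim (Sum.elim a' b) (j ∘ d)) → SameType j Set.univ a' a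

end Extension

/-! ### Invariant types and their canonical extensions -/

/-- `p` is `A`-invariant. (Additional parameters from `A` in `φ` may be appended to both
`b` and `b'`.) -/
def InvariantOver (p : GlobalType L M α) (A : Set M) : Prop :=
  ∀ (k : ℕ) (φ : L.Formula (α ⊕ Fin k)) (b b' : Fin k → M),
    SameType (ElementaryEmbedding.refl L M) A b b' → (Has p φ b ↔ Has p φ b')

/-- `a ⊨ p ↾ B`, for a tuple `a` of `M` and `B ⊆ M`. -/
def RealizesOn (p : GlobalType L M α) (B : Set M) (a : α → M) : Prop :=
  ∀ (k : ℕ) (φ : L.Formula (α ⊕ Fin k)) (c : Fin k → M), (∀ i, c i ∈ B) →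
    Has p φ c → φ.Realize (Sum.elim a c)

section Extension

variable {N : Type u} [L.Structure N] (j : M ↪ₑ[L] N)

/-- `φ(x, c)` belongs to the canonical extension of the `A`-invariant type `p` to `N`, where `c` is
a tuple of `N`: one has `φ(x, c') ∈ p` for a tuple `c'` of `M` with the same type over `A` as `c`
(by invariance it does not matter which one). -/
def ExtensionHas (p : GlobalType L M α) (A : Set M) {k : ℕ} (φ : L.Formula (α ⊕ Fin k))
    (c : Fin k → N) : Prop :=
  ∃ c' : Fin k → M, SameType j A (j ∘ c') c ∧ Has p φ c'

/-- `a ⊨ p ↾ M b`, for tuples `a`, `b` of `N` and an invariant type `p`: `a` realizes the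
restriction to `M ∪ b` of the canonical extension of `p` to `N`. (In a monster model the extension
is the same for all small sets `A` over which `p` is invariant.) -/
def RealizesOver (κ : Cardinal.{u}) (p : GlobalType L M α) (b : β → N) (a : α → N) : Prop :=
  ∃ A : Set M, #A < κ ∧ InvariantOver p A ∧
    ∀ (k : ℕ) (φ : L.Formula (α ⊕ Fin k)) (c : Fin k → N),
      (∀ i, c i ∈ Set.range j ∪ Set.range b) →
      ExtensionHas j p A φ c → φ.Realize (Sum.elim a c)

end Extension

/-! ### Generic stability and strong regularity -/

/-- `(a_i)_{i ∈ ι}` is a Morley sequence in `p` over `A`: `a_i ⊨ p ↾ A a_{<i}` for all `i`. -/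
def IsMorley (p : GlobalType L M α) (A : Set M) {ι : Type u} [LinearOrder ι]
    (a : ι → α → M) : Prop :=
  ∀ i, RealizesOn p (A ∪ ⋃ l : Set.Iio i, Set.range (a l)) (a i)

/-- `p` is generically stable (the ordinals in the definition are represented by well-ordered
types). -/
def GenericallyStable (κ : Cardinal.{u}) (p : GlobalType L M α) : Prop :=
  NonAlgebraic p ∧ ∃ A : Set M, #A < κ ∧ InvariantOver p A ∧
    ∀ (ι : Type u) [LinearOrder ι] [WellFoundedLT ι] [Infinite ι] (a : ι → α → M),
      IsMorley p A a →
      ∀ (k : ℕ) (φ : L.Formula (α ⊕ Fin k)) (c : Fin k → M),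
        {i | φ.Realize (Sum.elim (a i) c)}.Finite ∨ {i | ¬ φ.Realize (Sum.elim (a i) c)}.Finite

/-- The pair `(p(x), φ(x, c))` is strongly regular. Since `B ∪ a` is small and `M` is saturated,
`p ↾ B ⊢ p ↾ B a` means that every realization of `p ↾ B` in `M` realizes `p ↾ B a`. -/
def StronglyRegularPair (κ : Cardinal.{u}) (p : GlobalType L M α) {k : ℕ}
    (φ : L.Formula (α ⊕ Fin k)) (c : Fin k → M) : Prop :=
  NonAlgebraic p ∧ ∃ A : Set M, #A < κ ∧ InvariantOver p A ∧ (∀ i, c i ∈ A) ∧ Has p φ c ∧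
    ∀ B : Set M, A ⊆ B → #B < κ → ∀ a : α → M, φ.Realize (Sum.elim a c) →
      RealizesOn p B a ∨ ∀ x : α → M, RealizesOn p B x → RealizesOn p (B ∪ Set.range a) x

/-- `p` is strongly regular. -/
def StronglyRegular (κ : Cardinal.{u}) (p : GlobalType L M α) : Prop :=
  ∃ (k : ℕ) (φ : L.Formula (α ⊕ Fin k)) (c : Fin k → M), StronglyRegularPair κ p φ c

/-! ### Orthogonality and the Rudin–Keisler order -/

/-- `p(x) ⊥ q(y)`: `p(x) ∪ q(y)` determines a complete type over `M` in the variables `x, y`. -/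
def Orthogonal (p : GlobalType L M α) (q : GlobalType L M β) : Prop :=
  ∃! r : GlobalType L M (α ⊕ β),
    (∀ (k : ℕ) (φ : L.Formula (α ⊕ Fin k)) (c : Fin k → M),
      Has p φ c → Has r (Formula.relabel (Sum.map Sum.inl id) φ) c) ∧
    (∀ (k : ℕ) (φ : L.Formula (β ⊕ Fin k)) (c : Fin k → M),
      Has q φ c → Has r (Formula.relabel (Sum.map Sum.inr id) φ) c)

/-- `p ≤_RK q`. -/
def RKLe (p : GlobalType L M α) (q : GlobalType L M β) : Prop :=
  ∃ (N : Type u) (_ : L.Structure N) (j : M ↪ₑ[L] N) (a : α → N) (b : β → N),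
    Realizes j p a ∧ Realizes j q b ∧ SemiIsolatedBy j a b

/-- `p ≡_RK q` (strong RK-equivalence). -/
def StrongRKEquiv (p : GlobalType L M α) (q : GlobalType L M β) : Prop :=
  ∃ (N : Type u) (_ : L.Structure N) (j : M ↪ₑ[L] N) (a : α → N) (b : β → N),
    Realizes j p a ∧ Realizes j q b ∧ SemiIsolatedBy j a b ∧ SemiIsolatedBy j b a

/-- `p` is minimal, with respect to the quasi-order `≤_RK`, among the non-algebraic global types
in finitely many variables. -/
def RKMinimal (p : GlobalType L M α) : Prop :=
  NonAlgebraic p ∧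
    ∀ (m : ℕ) (q : GlobalType L M (Fin m)), NonAlgebraic q → RKLe q p → RKLe p q

end

end GlobalRK

open GlobalRK

/-! Say that a realization `a` of `p` depends on `b` if it does not realize the canonical extension
of `p` to `M b`. Everything rests on `semiIsolatedBy_of_not_realizesOver`: if `a` depends on `b`,
then `b` semi-isolates `a`.

Generic stability makes a formula outside `p` exclude long Morley sequences
(`exists_morleyFormula_of_not_has`): otherwise saturation moves its parameters, without changing
their type, so that a whole infinite Morley sequence satisfies it; continuing this sequence by terms
outside the formula contradicts the finite/cofinite alternative. By compactness `p` is definable,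
with a definition that still bounds sequences in elementary extensions (`exists_definition`), and
its canonical extension is finitely satisfiable in `M` (`exists_global_definition`).

If `a` depends on `b`, it lies in some `θ(x, b)` containing no long Morley sequence, up to finite
approximation. Take `r` such that every approximation of a Morley sequence of length `r` occurs
inside `θ(x, b)`, while some approximation `π` of length `r + 1` does not. If `a'` satisfied `θ(x,
b)`, the regularity formula and the condition `δ` expressing `π` for generic continuations, but not
`p`, strong regularity would keep generic sequences generic over points like `a'`. Prepending `a'`
to an `r`-sequence inside `θ(x, b)` would then give the forbidden `π`-sequence. So these three
conditions imply `p`.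

The rest produces dependent pairs. Semi-isolation of `b` by `a`, with `tp(b/M)` non-algebraic,
forces `a` to depend on `b`, since definability would otherwise pull `b` into `M`; this gives
minimality. If `p` and `q` are not orthogonal, some realizations depend, since independence together
with definability fixes the joint type; conversely, semi-isolation is incompatible with a coheir
completion. Finite satisfiability makes dependence symmetric, which gives strong equivalence. -/

namespace GlobalRK

open FirstOrder.Language

/-! ### Global types through their realizations in elementary extensions. -/

section Types

variable {L : FirstOrder.Language.{u, u}} {M : Type u} [L.Structure M] {α β γ : Type}

/-- The formula `φ(x, e)` belongs to `p`, where `e` is a tuple of elements of `M` indexed by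
an arbitrary type. -/
def Holds {P : Type*} (p : GlobalType L M α) (φ : L.Formula (α ⊕ P)) (e : P → M) : Prop :=
  Formula.equivSentence (BoundedFormula.constantsVarsEquiv.symm
    (Formula.relabel (Sum.elim Sum.inr (Sum.inl ∘ e) : α ⊕ P → M ⊕ α) φ) : L[[M]].Formula α) ∈ p

/-- Only finitely many parameters occur in a formula. -/
theorem exists_finite_parameters {δ P : Type*} (φ : L.Formula (δ ⊕ P)) :
    ∃ (k : ℕ) (φ₀ : L.Formula (δ ⊕ Fin k)) (s : Fin k → P),
      ∀ (N : Type u) [L.Structure N] (v : δ → N) (e : P → N),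
        φ₀.Realize (Sum.elim v (e ∘ s)) ↔ φ.Realize (Sum.elim v e) := by
  classical
  let S : Finset P := φ.freeVarFinset.toRight
  let t : φ.freeVarFinset → δ ⊕ Fin S.card := fun z =>
    match z with
    | ⟨Sum.inl d, _⟩ => Sum.inl d
    | ⟨Sum.inr q, h⟩ => Sum.inr (S.equivFin ⟨q, by simpa [S] using h⟩)
  refine ⟨S.card, φ.restrictFreeVar t, fun i => (S.equivFin.symm i : P), ?_⟩
  intro N _ v e
  refine BoundedFormula.realize_restrictFreeVar _ ?_
  rintro ⟨d | q, h⟩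
  · rfl
  · simp [t]

theorem exists_realization_of_sentences (p : GlobalType L M α) :
    ∃ (N : Type u) (_ : L.Structure N) (j : M ↪ₑ[L] N) (a : α → N),
      ∀ ξ : L[[M]].Formula α, Formula.equivSentence ξ ∈ p ↔
        Formula.Realize (BoundedFormula.constantsVarsEquiv ξ : L.Formula (M ⊕ α))
          (Sum.elim j a) := by
  obtain ⟨N, a, rfl⟩ := Theory.exists_modelType_is_realized_in _ p
  let _ : L.Structure N := (L.lhomWithConstants M).reduct N
  have : (L.lhomWithConstants M).IsExpansionOn N := LHom.isExpansionOn_reduct _ _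
  refine ⟨N, inferInstance, ElementaryEmbedding.ofModelsElementaryDiagram L M N, a, fun ξ => ?_⟩
  rw [Theory.CompleteType.formula_mem_typeOf]
  exact (BoundedFormula.realize_constantsVarsEquiv (M := N)).symm

theorem holds_iff_of_realization {N : Type u} [L.Structure N] {j : M ↪ₑ[L] N}
    {p : GlobalType L M α} {a : α → N}
    (h : ∀ ξ : L[[M]].Formula α, Formula.equivSentence ξ ∈ p ↔
      Formula.Realize (BoundedFormula.constantsVarsEquiv ξ : L.Formula (M ⊕ α)) (Sum.elim j a))
    {P : Type*} (φ : L.Formula (α ⊕ P)) (e : P → M) :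
    Holds p φ e ↔ φ.Realize (Sum.elim a (j ∘ e)) := by
  rw [Holds, h, Equiv.apply_symm_apply, Formula.realize_relabel]
  have : (Sum.elim (⇑j) a ∘ Sum.elim Sum.inr (Sum.inl ∘ e)) = Sum.elim a (j ∘ e) := by
    ext (x | x) <;> rfl
  rw [this]

theorem exists_realizes (p : GlobalType L M α) :
    ∃ (N : Type u) (_ : L.Structure N) (j : M ↪ₑ[L] N) (a : α → N), Realizes j p a := by
  obtain ⟨N, _, j, a, h⟩ := exists_realization_of_sentences p
  exact ⟨N, _, j, a, fun k φ c => holds_iff_of_realization h φ c⟩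

theorem Realizes.holds_iff {N : Type u} [L.Structure N] {j : M ↪ₑ[L] N}
    {p : GlobalType L M α} {a : α → N} (h : Realizes j p a)
    {P : Type*} (φ : L.Formula (α ⊕ P)) (e : P → M) :
    Holds p φ e ↔ φ.Realize (Sum.elim a (j ∘ e)) := by
  obtain ⟨N₁, _, j₁, a₁, h₁⟩ := exists_realization_of_sentences p
  obtain ⟨k, φ₀, s, hs⟩ := exists_finite_parameters φ
  rw [holds_iff_of_realization h₁, ← hs, ← hs]
  exact (holds_iff_of_realization h₁ φ₀ (e ∘ s)).symm.trans (h k φ₀ (e ∘ s))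

/-- Two global types with the same formulas over `M` are equal. -/
theorem globalType_ext {p q : GlobalType L M α}
    (h : ∀ (k : ℕ) (φ : L.Formula (α ⊕ Fin k)) (c : Fin k → M), Has p φ c ↔ Has q φ c) :
    p = q := by
  obtain ⟨N₁, _, j₁, a₁, h₁⟩ := exists_realization_of_sentences p
  obtain ⟨N₂, _, j₂, a₂, h₂⟩ := exists_realization_of_sentences q
  refine SetLike.ext fun χ => ?_
  obtain ⟨ξ, rfl⟩ := Formula.equivSentence.surjective χ
  rw [h₁, h₂]
  let ψ : L.Formula (α ⊕ M) :=
    Formula.relabel Sum.swap (BoundedFormula.constantsVarsEquiv ξ : L.Formula (M ⊕ α))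
  have key : ∀ (N : Type u) [L.Structure N] (j : M → N) (a : α → N),
      Formula.Realize (BoundedFormula.constantsVarsEquiv ξ : L.Formula (M ⊕ α)) (Sum.elim j a) ↔
        ψ.Realize (Sum.elim a j) := by
    intro N _ j a
    rw [Formula.realize_relabel]
    have : Sum.elim a j ∘ Sum.swap = Sum.elim j a := by ext (x | x) <;> rfl
    rw [this]
  obtain ⟨k, φ₀, s, hs⟩ := exists_finite_parameters ψ
  rw [key, key, ← hs, ← hs]
  exact ((holds_iff_of_realization h₁ φ₀ s).symm.trans (h k φ₀ s)).trans
    (holds_iff_of_realization h₂ φ₀ s)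

theorem realize_map {N : Type*} [L.Structure N] (j : M ↪ₑ[L] N) {γ P : Type*}
    (φ : L.Formula (γ ⊕ P)) (v : γ → M) (e : P → M) :
    φ.Realize (Sum.elim (j ∘ v) (j ∘ e)) ↔ φ.Realize (Sum.elim v e) := by
  rw [← Sum.comp_elim, j.map_formula]

/-- Compactness for sets of formulas over `M`. -/
theorem exists_globalType [Nonempty M] (Γ : Set (L.Formula (γ ⊕ M)))
    (hΓ : ∀ Γ₀ : Finset (L.Formula (γ ⊕ M)), (Γ₀ : Set (L.Formula (γ ⊕ M))) ⊆ Γ →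
      ∃ v : γ → M, ∀ φ ∈ Γ₀, φ.Realize (Sum.elim v id)) :
    ∃ r : GlobalType L M γ, ∀ φ ∈ Γ, Holds r φ id := by
  classical
  let F : L.Formula (γ ⊕ M) → L[[M]][[γ]].Sentence := fun φ =>
    Formula.equivSentence (BoundedFormula.constantsVarsEquiv.symm
      (Formula.relabel (Sum.elim Sum.inr (Sum.inl ∘ id) : γ ⊕ M → M ⊕ γ) φ) : L[[M]].Formula γ)
  suffices h : ((L[[M]].lhomWithConstants γ).onTheory (L.elementaryDiagram M) ∪
      F '' Γ).IsSatisfiable by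
    have h' := mt (Theory.CompleteType.setOfPred_subset_eq_empty_iff
      (T := L.elementaryDiagram M) (F '' Γ)).1 (not_not.2 h)
    obtain ⟨r, hr⟩ := Set.nonempty_iff_ne_empty.2 h'
    exact ⟨r, fun φ hφ => hr ⟨φ, hφ, rfl⟩⟩
  rw [Theory.isSatisfiable_iff_isFinitelySatisfiable]
  intro T₀ hT₀
  have : ∃ Γ₀ : Finset (L.Formula (γ ⊕ M)), (Γ₀ : Set (L.Formula (γ ⊕ M))) ⊆ Γ ∧
      (T₀ : Set (L[[M]][[γ]].Sentence)) ⊆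
        (L[[M]].lhomWithConstants γ).onTheory (L.elementaryDiagram M) ∪ F '' Γ₀ := by
    have h1 : ((T₀ : Set (L[[M]][[γ]].Sentence)) ∩ F '' Γ).Finite :=
      T₀.finite_toSet.subset Set.inter_subset_left
    obtain ⟨Γ₀, h2, h3⟩ := Set.exists_subset_image_finite_and.1
      ⟨_, Set.inter_subset_right, h1, rfl⟩
    refine ⟨h3.1.toFinset, by simpa using h2, fun χ hχ => ?_⟩
    rcases hT₀ hχ with h | h
    · exact Or.inl h
    · refine Or.inr ?_
      rw [Set.Finite.coe_toFinset, ← h3.2]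
      exact ⟨hχ, h⟩
  obtain ⟨Γ₀, h1, h2⟩ := this
  obtain ⟨v, hv⟩ := hΓ Γ₀ h1
  -- `M` itself is the model of the finite fragment, with the variables interpreted by `v`.
  let _ : (constantsOn γ).Structure M := constantsOn.structure v
  suffices hm : M ⊨ ((L[[M]].lhomWithConstants γ).onTheory (L.elementaryDiagram M) ∪ F '' Γ₀) by
    have : M ⊨ (T₀ : L[[M]][[γ]].Theory) := hm.mono h2
    exact Theory.Model.isSatisfiable M
  refine Theory.Model.union ((LHom.onTheory_model _ _).2 inferInstance) ⟨?_⟩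
  rintro _ ⟨φ, hφ, rfl⟩
  refine (Formula.realize_equivSentence M _).2 ?_
  refine (BoundedFormula.realize_constantsVarsEquiv (L := L) (M := M)).1 ?_
  rw [Equiv.apply_symm_apply]
  refine Formula.realize_relabel.2 ?_
  convert hv φ hφ using 1
  ext (x | x) <;> rfl

end Types

/-! ### Formulas over small sets, saturation and Morley sequences. -/

section Monster

variable {L : FirstOrder.Language.{u, u}} {M : Type u} [L.Structure M] {α β γ : Type}

theorem realize_relabel_of_comp {N : Type*} [L.Structure N] {γ δ : Type*} {φ : L.Formula γ}
    {g : γ → δ} {v : δ → N} {w : γ → N} (h : ∀ x, v (g x) = w x) :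
    (φ.relabel g).Realize v ↔ φ.Realize w := by
  rw [Formula.realize_relabel, show v ∘ g = w from funext h]

/-- Existential quantification over the variables indexed by `δ`. -/
noncomputable def ex {γ δ P : Type*} [Finite δ] (φ : L.Formula ((γ ⊕ δ) ⊕ P)) :
    L.Formula (γ ⊕ P) :=
  Formula.iExs δ (φ.relabel
    (Sum.elim (Sum.elim (Sum.inl ∘ Sum.inl) Sum.inr) (Sum.inl ∘ Sum.inr) :
      (γ ⊕ δ) ⊕ P → (γ ⊕ P) ⊕ δ))

theorem realize_ex {N : Type*} [L.Structure N] {γ δ P : Type*} [Finite δ]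
    {φ : L.Formula ((γ ⊕ δ) ⊕ P)} {v : γ → N} {e : P → N} :
    (ex φ).Realize (Sum.elim v e) ↔ ∃ w : δ → N, φ.Realize (Sum.elim (Sum.elim v w) e) := by
  rw [ex, Formula.realize_iExs]
  refine exists_congr fun w => realize_relabel_of_comp ?_
  rintro ((x | x) | x) <;> rfl

section Extension

variable {N : Type u} [L.Structure N] (j : M ↪ₑ[L] N)

theorem exists_realize_of_realize {γ P : Type*} [Finite γ] {φ : L.Formula (γ ⊕ P)}
    {e : P → M} {v : γ → N} (h : φ.Realize (Sum.elim v (j ∘ e))) :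
    ∃ w : γ → M, φ.Realize (Sum.elim w e) := by
  -- `ex` keeps a block of free variables; here that block is empty.
  let ψ : L.Formula ((Empty ⊕ γ) ⊕ P) := φ.relabel (Sum.map Sum.inr id)
  have h1 : (ex ψ).Realize (Sum.elim (j ∘ Empty.elim) (j ∘ e)) := by
    refine realize_ex.2 ⟨v, (realize_relabel_of_comp ?_).2 h⟩
    rintro (x | x) <;> rfl
  obtain ⟨w, hw⟩ := realize_ex.1 ((realize_map j _ _ _).1 h1)
  refine ⟨w, (realize_relabel_of_comp ?_).1 hw⟩
  rintro (x | x) <;> rfl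

theorem exists_forall_realize_of_realize {γ P : Type*} [Finite γ]
    {Γ : Set (L.Formula (γ ⊕ P))} (hΓ : Γ.Finite) {e : P → M} {v : γ → N}
    (h : ∀ φ ∈ Γ, φ.Realize (Sum.elim v (j ∘ e))) :
    ∃ w : γ → M, ∀ φ ∈ Γ, φ.Realize (Sum.elim w e) := by
  have : Finite Γ := hΓ
  obtain ⟨w, hw⟩ := exists_realize_of_realize j
    (φ := Formula.iInf (fun φ : Γ => (φ : L.Formula (γ ⊕ P)))) (e := e) (v := v)
    (Formula.realize_iInf.2 fun φ => h φ φ.2)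
  exact ⟨w, fun φ hφ => Formula.realize_iInf.1 hw ⟨φ, hφ⟩⟩

variable {j}

theorem SameType.realize_iff {A : Set M} {b b' : β → N} (h : SameType j A b b')
    {P : Type*} (ψ : L.Formula (β ⊕ P)) {e : P → M} (he : ∀ x, e x ∈ A) :
    ψ.Realize (Sum.elim b (j ∘ e)) ↔ ψ.Realize (Sum.elim b' (j ∘ e)) := by
  obtain ⟨k, ψ₀, s, hs⟩ := exists_finite_parameters ψ
  rw [← hs, ← hs]
  exact h k ψ₀ (e ∘ s) fun i => he _

theorem sameType_of_forall {A : Set M} {b b' : β → N}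
    (h : ∀ ψ : L.Formula (β ⊕ A), ψ.Realize (Sum.elim b (j ∘ Subtype.val)) →
      ψ.Realize (Sum.elim b' (j ∘ Subtype.val))) : SameType j A b b' := by
  have h' : ∀ ψ : L.Formula (β ⊕ A), ψ.Realize (Sum.elim b (j ∘ Subtype.val)) ↔
      ψ.Realize (Sum.elim b' (j ∘ Subtype.val)) := fun ψ => by
    refine ⟨h ψ, fun hb' => by_contra fun hb => ?_⟩
    exact Formula.realize_not.1 (h (∼ψ) (Formula.realize_not.2 hb)) hb'
  intro k ψ d hd
  have h1 := h' (ψ.relabel (Sum.map id fun i => ⟨d i, hd i⟩))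
  rwa [realize_relabel_of_comp (w := Sum.elim b (j ∘ d)) (by rintro (x | x) <;> rfl),
    realize_relabel_of_comp (w := Sum.elim b' (j ∘ d)) (by rintro (x | x) <;> rfl)] at h1

theorem SameType.mono {A B : Set M} (hAB : A ⊆ B) {b b' : β → N} (h : SameType j B b b') :
    SameType j A b b' :=
  fun k ψ d hd => h k ψ d fun i => hAB (hd i)

theorem SameType.symm {A : Set M} {b b' : β → N} (h : SameType j A b b') : SameType j A b' b :=
  fun k ψ d hd => (h k ψ d hd).symm

end Extension

theorem holds_not {P : Type*} {p : GlobalType L M α} {φ : L.Formula (α ⊕ P)} {e : P → M} :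
    Holds p (∼φ) e ↔ ¬ Holds p φ e := by
  obtain ⟨N, _, j, a, h⟩ := exists_realizes p
  rw [h.holds_iff, h.holds_iff, Formula.realize_not]

/-- One realization decides membership in a type, so relabelling of variables and parameters can be
checked semantically. -/
theorem holds_congr {P Q : Type*} {p : GlobalType L M α} {φ : L.Formula (α ⊕ P)} {e : P → M}
    {ψ : L.Formula (α ⊕ Q)} {f : Q → M}
    (h : ∀ (N : Type u) [L.Structure N] (j : M ↪ₑ[L] N) (a : α → N),
      φ.Realize (Sum.elim a (j ∘ e)) ↔ ψ.Realize (Sum.elim a (j ∘ f))) :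
    Holds p φ e ↔ Holds p ψ f := by
  obtain ⟨N, _, j, a, hp⟩ := exists_realizes p
  rw [hp.holds_iff, hp.holds_iff, h]

theorem exists_has_iff_holds {P : Type*} (φ : L.Formula (α ⊕ P)) :
    ∃ (k : ℕ) (φ₀ : L.Formula (α ⊕ Fin k)) (s : Fin k → P),
      (∀ (N : Type u) [L.Structure N] (v : α → N) (e : P → N),
        φ₀.Realize (Sum.elim v (e ∘ s)) ↔ φ.Realize (Sum.elim v e)) ∧
      ∀ (p : GlobalType L M α) (e : P → M), Has p φ₀ (e ∘ s) ↔ Holds p φ e := by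
  obtain ⟨k, φ₀, s, hs⟩ := exists_finite_parameters φ
  exact ⟨k, φ₀, s, hs, fun p e => holds_congr (ψ := φ) fun N _ j a => hs N a (j ∘ e)⟩

theorem InvariantOver.holds_iff {p : GlobalType L M α} {A : Set M} (hp : InvariantOver p A)
    {P : Type*} {e e' : P → M}
    (h : ∀ ψ : L.Formula (P ⊕ A), ψ.Realize (Sum.elim e Subtype.val) ↔
      ψ.Realize (Sum.elim e' Subtype.val)) (φ : L.Formula (α ⊕ P)) :
    Holds p φ e ↔ Holds p φ e' := by
  obtain ⟨k, φ₀, s, -, hs⟩ := exists_has_iff_holds (M := M) φ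
  rw [← hs, ← hs]
  refine hp k φ₀ _ _ (sameType_of_forall fun ψ hψ => ?_)
  have h1 := (h (ψ.relabel (Sum.map s id))).1
    ((realize_relabel_of_comp (by rintro (x | x) <;> rfl)).2 hψ)
  exact (realize_relabel_of_comp (by rintro (x | x) <;> rfl)).1 h1

theorem InvariantOver.mono {p : GlobalType L M α} {A B : Set M} (hp : InvariantOver p A)
    (hAB : A ⊆ B) : InvariantOver p B :=
  fun k φ b b' h => hp k φ b b' (h.mono hAB)

theorem RealizesOn.holds_iff {p : GlobalType L M α} {B : Set M} {a : α → M}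
    (h : RealizesOn p B a) {P : Type*} (φ : L.Formula (α ⊕ P)) {e : P → M} (he : ∀ x, e x ∈ B) :
    Holds p φ e ↔ φ.Realize (Sum.elim a e) := by
  have key : ∀ ψ : L.Formula (α ⊕ P), Holds p ψ e → ψ.Realize (Sum.elim a e) := by
    intro ψ hψ
    obtain ⟨k, ψ₀, s, h1, h2⟩ := exists_has_iff_holds (M := M) ψ
    rw [← h1]
    exact h k ψ₀ _ (fun i => he _) ((h2 _ _).2 hψ)
  refine ⟨key φ, fun hφ => by_contra fun hn => ?_⟩
  exact Formula.realize_not.1 (key _ (holds_not.2 hn)) hφ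

theorem RealizesOn.mono {p : GlobalType L M α} {A B : Set M} (hAB : A ⊆ B) {a : α → M}
    (h : RealizesOn p B a) : RealizesOn p A a :=
  fun k φ c hc => h k φ c fun i => hAB (hc i)

/-! ### Small sets and saturation -/

variable {κ : Cardinal.{u}}

theorem IsMonster.small_union (hM : IsMonster L M κ) {A B : Set M} (hA : #A < κ) (hB : #B < κ) :
    #(A ∪ B : Set M) < κ :=
  (mk_union_le A B).trans_lt (add_lt_of_lt hM.aleph0_lt.le hA hB)

theorem IsMonster.small_of_countable (hM : IsMonster L M κ) {A : Set M} (hA : A.Countable) :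
    #A < κ :=
  (le_aleph0_iff_set_countable.2 hA).trans_lt hM.aleph0_lt

theorem IsMonster.small_union_range (hM : IsMonster L M κ) {A : Set M} (hA : #A < κ)
    {ι : Type*} [Countable ι] (c : ι → M) : #(A ∪ Set.range c : Set M) < κ :=
  hM.small_union hA (hM.small_of_countable (Set.countable_range c))

theorem IsMonster.exists_forall_realize (hM : IsMonster L M κ) {B : Set M} (hB : #B < κ) {n : ℕ}
    {ι : Type*} (F : ι → L.Formula (Fin n ⊕ B))
    (hF : ∀ s : Finset ι, ∃ a : Fin n → M, ∀ i ∈ s, (F i).Realize (Sum.elim a Subtype.val)) :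
    ∃ a : Fin n → M, ∀ i, (F i).Realize (Sum.elim a Subtype.val) := by
  classical
  obtain ⟨a, ha⟩ := hM.saturated B hB n (Set.range F) (by
    intro Γ₀ h1 h2
    obtain ⟨s, -, hs1, rfl⟩ := Set.exists_subset_image_finite_and.1
      ⟨Γ₀, by rwa [Set.image_univ], h2, rfl⟩
    obtain ⟨a, ha⟩ := hF hs1.toFinset
    refine ⟨a, ?_⟩
    rintro _ ⟨i, hi, rfl⟩
    exact ha i (by simpa using hi))
  exact ⟨a, fun i => ha _ ⟨i, rfl⟩⟩

theorem IsMonster.exists_sameType (hM : IsMonster L M κ) {N : Type u} [L.Structure N]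
    (j : M ↪ₑ[L] N) {A : Set M} (hA : #A < κ) {k : ℕ} (c : Fin k → N) :
    ∃ c' : Fin k → M, SameType j A (j ∘ c') c := by
  obtain ⟨c', hc'⟩ := hM.saturated A hA k
    {ψ | ψ.Realize (Sum.elim c (j ∘ Subtype.val))} fun Γ₀ h h' =>
      exists_forall_realize_of_realize j h' fun φ hφ => h hφ
  refine ⟨c', (sameType_of_forall fun ψ hψ => ?_).symm⟩
  exact (realize_map j ψ c' _).2 (hc' ψ hψ)

theorem IsMonster.exists_realizesOn (hM : IsMonster L M κ) {n : ℕ} (p : GlobalType L M (Fin n))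
    {B : Set M} (hB : #B < κ) : ∃ a, RealizesOn p B a := by
  obtain ⟨N, _, j, b, hb⟩ := exists_realizes p
  obtain ⟨a, ha⟩ := hM.exists_sameType j hB b
  refine ⟨a, fun k φ c hc h => ?_⟩
  exact (realize_map j φ a c).1 ((ha k φ c hc).2 ((hb k φ c).1 h))

/-! ### Morley sequences -/

/-- `(x_i)_{i < n}` is a finite Morley sequence in `p` over `B`. -/
def IsFinMorley (p : GlobalType L M α) (B : Set M) {n : ℕ} (x : Fin n → α → M) : Prop :=
  ∀ i, RealizesOn p (B ∪ {m | ∃ l < i, m ∈ Set.range (x l)}) (x i)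

/-- `(x_i)_{i < ω}` is a Morley sequence in `p` over `B`. -/
def IsNatMorley (p : GlobalType L M α) (B : Set M) (x : ℕ → α → M) : Prop :=
  ∀ i, RealizesOn p (B ∪ {m | ∃ l < i, m ∈ Set.range (x l)}) (x i)

theorem IsNatMorley.isFinMorley {p : GlobalType L M α} {B : Set M} {x : ℕ → α → M}
    (h : IsNatMorley p B x) (n : ℕ) : IsFinMorley p B fun i : Fin n => x i := by
  refine fun i => (h i).mono (Set.union_subset_union_right _ ?_)
  rintro m ⟨l, hl, hm⟩
  exact ⟨l, hl, hm⟩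

theorem IsFinMorley.mono {p : GlobalType L M α} {A B : Set M} (hAB : A ⊆ B) {n : ℕ}
    {x : Fin n → α → M} (h : IsFinMorley p B x) : IsFinMorley p A x :=
  fun i => (h i).mono (Set.union_subset_union_left _ hAB)

theorem IsFinMorley.realizesOn {p : GlobalType L M α} {B : Set M} {n : ℕ}
    {x : Fin n → α → M} (h : IsFinMorley p B x) (i : Fin n) : RealizesOn p B (x i) :=
  (h i).mono Set.subset_union_left

theorem IsFinMorley.tail {p : GlobalType L M α} {B : Set M} {n : ℕ}
    {x : Fin (n + 1) → α → M} (h : IsFinMorley p B x) :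
    IsFinMorley p (B ∪ Set.range (x 0)) (Fin.tail x) := by
  refine fun i => (h i.succ).mono ?_
  rintro m ((hm | hm) | ⟨l, hl, hm⟩)
  · exact Or.inl hm
  · exact Or.inr ⟨0, Fin.succ_pos i, hm⟩
  · exact Or.inr ⟨l.succ, Fin.succ_lt_succ_iff.2 hl, hm⟩

theorem IsMonster.exists_isNatMorley (hM : IsMonster L M κ) {n : ℕ} (p : GlobalType L M (Fin n))
    {B : Set M} (hB : #B < κ) : ∃ x : ℕ → Fin n → M, IsNatMorley p B x := by
  have key : ∀ (i : ℕ) (g : ∀ l, l < i → Fin n → M),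
      ∃ a, RealizesOn p (B ∪ {m | ∃ l, ∃ h : l < i, m ∈ Set.range (g l h)}) a := by
    intro i g
    refine hM.exists_realizesOn p (hM.small_union hB (hM.small_of_countable ?_))
    have : {m | ∃ l, ∃ h : l < i, m ∈ Set.range (g l h)} =
        ⋃ l : {l // l < i}, Set.range (g l l.2) := by
      ext m
      simp
    rw [this]
    exact Set.countable_iUnion fun l => Set.countable_range _
  choose f hf using key
  let x : ℕ → Fin n → M := Nat.lt_wfRel.wf.fix f
  refine ⟨x, fun i => ?_⟩
  have hx : x i = f i fun l _ => x l := Nat.lt_wfRel.wf.fix_eq f i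
  rw [hx]
  refine (hf i fun l _ => x l).mono (Set.union_subset_union_right _ ?_)
  rintro m ⟨l, hl, hm⟩
  exact ⟨l, hl, hm⟩

theorem IsMonster.exists_isFinMorley (hM : IsMonster L M κ) {n : ℕ} (p : GlobalType L M (Fin n))
    {B : Set M} (hB : #B < κ) (r : ℕ) : ∃ x : Fin r → Fin n → M, IsFinMorley p B x :=
  let ⟨_, hx⟩ := hM.exists_isNatMorley p hB
  ⟨_, hx.isFinMorley r⟩

/-- Finite Morley sequences of the same length over bases with the same type over `A` have the
same type over `A`. -/
theorem InvariantOver.realize_iff_of_isFinMorley {p : GlobalType L M α} {A : Set M}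
    (hp : InvariantOver p A) (n : ℕ) :
    ∀ {β : Type} {c c' : β → M}, (∀ ψ : L.Formula (β ⊕ A), ψ.Realize (Sum.elim c Subtype.val) ↔
      ψ.Realize (Sum.elim c' Subtype.val)) →
    ∀ {x x' : Fin n → α → M}, IsFinMorley p (A ∪ Set.range c) x →
      IsFinMorley p (A ∪ Set.range c') x' →
    ∀ ψ : L.Formula ((β ⊕ (Fin n × α)) ⊕ A),
      ψ.Realize (Sum.elim (Sum.elim c (Function.uncurry x)) Subtype.val) ↔
        ψ.Realize (Sum.elim (Sum.elim c' (Function.uncurry x')) Subtype.val) := by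
  induction n with
  | zero =>
    intro β c c' h x x' _ _ ψ
    have := h (ψ.relabel
      (Sum.map (Sum.elim id fun z => z.1.elim0) id : (β ⊕ (Fin 0 × α)) ⊕ A → β ⊕ A))
    rwa [realize_relabel_of_comp (w := Sum.elim (Sum.elim c (Function.uncurry x)) Subtype.val)
        (by rintro ((y | y) | y); exacts [rfl, y.1.elim0, rfl]),
      realize_relabel_of_comp (w := Sum.elim (Sum.elim c' (Function.uncurry x')) Subtype.val)
        (by rintro ((y | y) | y); exacts [rfl, y.1.elim0, rfl])] at this
  | succ n ih =>
    intro β c c' h x x' hx hx' ψ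
    -- The first term joins the base tuple: `x 0` and `x' 0` realize `p` over bases of the same
    -- type, and invariance compares them. The induction therefore has to vary `β`.
    have h0 : ∀ χ : L.Formula ((β ⊕ α) ⊕ A),
        χ.Realize (Sum.elim (Sum.elim c (x 0)) Subtype.val) ↔
          χ.Realize (Sum.elim (Sum.elim c' (x' 0)) Subtype.val) := by
      intro χ
      let χ' : L.Formula (α ⊕ (β ⊕ A)) := χ.relabel
        (Sum.elim (Sum.elim (Sum.inr ∘ Sum.inl) Sum.inl) (Sum.inr ∘ Sum.inr))
      have e1 : ∀ (d : β → M) (y : α → M),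
          χ'.Realize (Sum.elim y (Sum.elim d Subtype.val)) ↔
            χ.Realize (Sum.elim (Sum.elim d y) Subtype.val) := fun d y =>
        realize_relabel_of_comp (by rintro ((z | z) | z) <;> rfl)
      rw [← e1, ← e1, ← (hx.realizesOn 0).holds_iff χ'
          (by rintro (z | z); exacts [Or.inr ⟨z, rfl⟩, Or.inl z.2]),
        ← (hx'.realizesOn 0).holds_iff χ'
          (by rintro (z | z); exacts [Or.inr ⟨z, rfl⟩, Or.inl z.2])]
      refine hp.holds_iff (fun ζ => ?_) χ'
      have := h (ζ.relabel (Sum.elim id Sum.inr : (β ⊕ A) ⊕ A → β ⊕ A))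
      rwa [realize_relabel_of_comp (w := Sum.elim (Sum.elim c Subtype.val) Subtype.val)
          (by rintro ((y | y) | y) <;> rfl),
        realize_relabel_of_comp (w := Sum.elim (Sum.elim c' Subtype.val) Subtype.val)
          (by rintro ((y | y) | y) <;> rfl)] at this
    have sub : ∀ (d : β → M) (y : α → M),
        A ∪ Set.range (Sum.elim d y) ⊆ (A ∪ Set.range d) ∪ Set.range y := by
      intro d y
      rw [Set.Sum.elim_range, Set.union_assoc]
    have := ih h0 (hx.tail.mono (sub _ _)) (hx'.tail.mono (sub _ _))
      (ψ.relabel (Sum.map (Sum.elim (Sum.inl ∘ Sum.inl) fun z =>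
        Fin.cases (Sum.inl (Sum.inr z.2)) (fun i => Sum.inr (i, z.2)) z.1) id))
    rwa [realize_relabel_of_comp (w := Sum.elim (Sum.elim c (Function.uncurry x)) Subtype.val) ?_,
      realize_relabel_of_comp
        (w := Sum.elim (Sum.elim c' (Function.uncurry x')) Subtype.val) ?_] at this
    · rintro ((y | ⟨i, y⟩) | y)
      · rfl
      · refine Fin.cases ?_ (fun i => ?_) i <;> rfl
      · rfl
    · rintro ((y | ⟨i, y⟩) | y)
      · rfl
      · refine Fin.cases ?_ (fun i => ?_) i <;> rfl
      · rfl

end Monster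

/-! ### Definability of generically stable types. -/

section Definability

variable {L : FirstOrder.Language.{u, u}} {M : Type u} [L.Structure M] {α β γ : Type}
variable {κ : Cardinal.{u}}

/-- Every formula over `M` is true at almost all or at almost no elements of an infinite
well-ordered Morley sequence in `p` over `A`. -/
def StableSequences (p : GlobalType L M α) (A : Set M) : Prop :=
  ∀ (ι : Type u) [LinearOrder ι] [WellFoundedLT ι] [Infinite ι] (a : ι → α → M),
    IsMorley p A a → ∀ (k : ℕ) (φ : L.Formula (α ⊕ Fin k)) (c : Fin k → M),
      {i | φ.Realize (Sum.elim (a i) c)}.Finite ∨ {i | ¬ φ.Realize (Sum.elim (a i) c)}.Finite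

theorem StableSequences.mono {p : GlobalType L M α} {A B : Set M} (hp : StableSequences p A)
    (hAB : A ⊆ B) : StableSequences p B :=
  fun ι _ _ _ a ha => hp ι a fun i => (ha i).mono (Set.union_subset_union_left _ hAB)

/-- Otherwise the sequence can be continued by a Morley sequence outside the formula; the
concatenation, of order type `ω + ω`, has infinitely many terms on either side. -/
theorem StableSequences.has_of_forall (hM : IsMonster L M κ) {n : ℕ}
    {p : GlobalType L M (Fin n)} {A : Set M} (hA : #A < κ) (hp : StableSequences p A)
    {x : ℕ → Fin n → M} (hx : IsNatMorley p A x) {k : ℕ} {φ : L.Formula (Fin n ⊕ Fin k)}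
    {c : Fin k → M} (h : ∀ i, φ.Realize (Sum.elim (x i) c)) : Has p φ c := by
  by_contra hn
  have hn' : Holds p (∼φ) c := holds_not.2 hn
  -- Including `x` makes the concatenation a Morley sequence over `A`; including `c` makes `φ` fail
  -- at each new term.
  let B : Set M := (A ∪ Set.range (Function.uncurry x)) ∪ Set.range c
  have hB : #B < κ := hM.small_union_range (hM.small_union_range hA _) _
  obtain ⟨y, hy⟩ := hM.exists_isNatMorley p hB
  have hyc : ∀ i, ¬ φ.Realize (Sum.elim (y i) c) := fun i => by
    have h1 : RealizesOn p B (y i) := (hy i).mono Set.subset_union_left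
    exact Formula.realize_not.1 ((h1.holds_iff (∼φ) fun z => Or.inr ⟨z, rfl⟩).1 hn')
  let z : ULift.{u} (ℕ ⊕ₗ ℕ) → Fin n → M := fun i => Sum.elim x y (ofLex i.down)
  have hwf : WellFoundedLT (ULift.{u} (ℕ ⊕ₗ ℕ)) :=
    ⟨InvImage.wf (fun i : ULift.{u} (ℕ ⊕ₗ ℕ) => i.down) (Sum.lex_wf wellFounded_lt wellFounded_lt)⟩
  have hz : IsMorley p A z := by
    rintro ⟨i⟩
    induction i using Lex.rec with | _ i =>
    rcases i with i | i
    · refine (hx i).mono (Set.union_subset_union_right _ (Set.iUnion_subset ?_))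
      rintro ⟨⟨l⟩, hl⟩
      induction l using Lex.rec with | _ l =>
      rcases l with l | l
      · exact fun m hm => ⟨l, Sum.Lex.inl_lt_inl_iff.1 hl, hm⟩
      · exact absurd hl Sum.Lex.not_inr_lt_inl
    · refine (hy i).mono (Set.union_subset ?_ (Set.iUnion_subset ?_))
      · exact fun m hm => Or.inl (Or.inl (Or.inl hm))
      rintro ⟨⟨l⟩, hl⟩
      induction l using Lex.rec with | _ l =>
      rcases l with l | l
      · rintro _ ⟨t, rfl⟩
        exact Or.inl (Or.inl (Or.inr ⟨(l, t), rfl⟩))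
      · exact fun m hm => Or.inr ⟨l, Sum.Lex.inr_lt_inr_iff.1 hl, hm⟩
  rcases hp _ z hz k φ c with hf | hf
  · refine Set.infinite_of_injective_forall_mem (f := fun i : ℕ => ULift.up (Sum.inlₗ i))
      (fun i l hil => ?_) (fun i => ?_) hf
    · simpa using hil
    · exact h i
  · refine Set.infinite_of_injective_forall_mem (f := fun i : ℕ => ULift.up (Sum.inrₗ i))
      (fun i l hil => ?_) (fun i => ?_) hf
    · simpa using hil
    · exact hyc i

/-- There are `x_0, …, x_{r-1}` satisfying `π(x_0, …, x_{r-1})` and each `φ(x_i, z)`. -/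
noncomputable def exSeq {r : ℕ} [Finite α] {P : Type*} (π : L.Formula ((Fin r × α) ⊕ P))
    (φ : L.Formula (α ⊕ γ)) : L.Formula (γ ⊕ P) :=
  ex (π.relabel (Sum.map Sum.inr id) ⊓ Formula.iInf fun i : Fin r =>
    φ.relabel (Sum.elim (fun t => Sum.inl (Sum.inr (i, t))) fun z => Sum.inl (Sum.inl z)))

theorem realize_exSeq {r : ℕ} [Finite α] {P : Type*} {π : L.Formula ((Fin r × α) ⊕ P)}
    {φ : L.Formula (α ⊕ γ)} {N : Type*} [L.Structure N] {v : γ → N} {e : P → N} :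
    (exSeq π φ).Realize (Sum.elim v e) ↔ ∃ x : Fin r → α → N,
      π.Realize (Sum.elim (Function.uncurry x) e) ∧ ∀ i, φ.Realize (Sum.elim (x i) v) := by
  have key : ∀ x : Fin r → α → N, ((π.relabel (Sum.map Sum.inr id) ⊓ Formula.iInf fun i : Fin r =>
        φ.relabel (Sum.elim (fun t => Sum.inl (Sum.inr (i, t))) fun z => Sum.inl (Sum.inl z)) :
          L.Formula ((γ ⊕ (Fin r × α)) ⊕ P))).Realize
        (Sum.elim (Sum.elim v (Function.uncurry x)) e) ↔
      π.Realize (Sum.elim (Function.uncurry x) e) ∧ ∀ i, φ.Realize (Sum.elim (x i) v) := by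
    intro x
    rw [Formula.realize_inf, Formula.realize_iInf]
    refine and_congr (realize_relabel_of_comp ?_)
      (forall_congr' fun i => realize_relabel_of_comp ?_) <;> rintro (y | y) <;> rfl
  rw [exSeq, realize_ex]
  exact ⟨fun ⟨w, hw⟩ => ⟨Function.curry w, (key _).1 (by rwa [Function.uncurry_curry])⟩,
    fun ⟨x, hx⟩ => ⟨_, (key x).2 hx⟩⟩

/-- Formulas over `A` that are true at the Morley sequences of length `r` in `p` over `A`. -/
def MorleyFormula (p : GlobalType L M α) (A : Set M) (r : ℕ) : Set (L.Formula ((Fin r × α) ⊕ A)) :=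
  {π | ∀ x : Fin r → α → M, IsFinMorley p A x →
    π.Realize (Sum.elim (Function.uncurry x) Subtype.val)}

/-- If every finite approximation of a Morley sequence occurred inside `φ(x, c)`, saturation would
give `d` of the same type as `c` over `A` with a fixed infinite Morley sequence inside `φ(x, d)`.
Then `φ(x, d)`, hence `φ(x, c)`, would belong to `p`. -/
theorem exists_morleyFormula_of_not_has (hM : IsMonster L M κ) {n : ℕ}
    {p : GlobalType L M (Fin n)} {A : Set M} (hA : #A < κ) (hi : InvariantOver p A)
    (hp : StableSequences p A) {k : ℕ} {φ : L.Formula (Fin n ⊕ Fin k)} {c : Fin k → M}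
    (h : ¬ Has p φ c) :
    ∃ r, ∃ π ∈ MorleyFormula p A r, ¬ (exSeq π φ).Realize (Sum.elim c Subtype.val) := by
  classical
  by_contra! H
  obtain ⟨x, hx⟩ := hM.exists_isNatMorley p hA
  let B : Set M := A ∪ Set.range (Function.uncurry x)
  have hB : #B < κ := hM.small_union_range hA _
  let I := {σ : L.Formula (Fin k ⊕ A) // σ.Realize (Sum.elim c Subtype.val)}
  let F : I ⊕ ℕ → L.Formula (Fin k ⊕ B) := Sum.elim
    (fun σ => σ.1.relabel (Sum.map id (Set.inclusion Set.subset_union_left)))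
    (fun i => φ.relabel (Sum.elim (fun t => Sum.inr ⟨x i t, Or.inr ⟨(i, t), rfl⟩⟩) Sum.inl))
  have hF1 : ∀ (σ : I) (d : Fin k → M), (F (Sum.inl σ)).Realize (Sum.elim d Subtype.val) ↔
      σ.1.Realize (Sum.elim d Subtype.val) := fun σ d =>
    realize_relabel_of_comp (by rintro (y | y) <;> rfl)
  have hF2 : ∀ (i : ℕ) (d : Fin k → M), (F (Sum.inr i)).Realize (Sum.elim d Subtype.val) ↔
      φ.Realize (Sum.elim (x i) d) := fun i d =>
    realize_relabel_of_comp (by rintro (y | y) <;> rfl)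
  obtain ⟨d, hd⟩ := hM.exists_forall_realize hB F (by
    intro s
    obtain ⟨r, hr⟩ : ∃ r, ∀ i ∈ s.toRight, i < r :=
      ⟨s.toRight.sup id + 1, fun i hi => Nat.lt_succ_of_le (Finset.le_sup (f := id) hi)⟩
    let σ : L.Formula (Fin k ⊕ A) := Formula.iInf fun σ : s.toLeft => σ.1.1
    let ρ : L.Formula ((Fin r × Fin n) ⊕ A) :=
      ex (σ.relabel (Sum.map Sum.inr id) ⊓ Formula.iInf fun i : Fin r =>
        φ.relabel (Sum.elim (fun t => Sum.inl (Sum.inl (i, t))) fun z => Sum.inl (Sum.inr z)))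
    have hρ : ∀ y : Fin r → Fin n → M,
        ρ.Realize (Sum.elim (Function.uncurry y) Subtype.val) ↔
          ∃ d : Fin k → M, σ.Realize (Sum.elim d Subtype.val) ∧
            ∀ i, φ.Realize (Sum.elim (y i) d) := by
      intro y
      rw [realize_ex]
      refine exists_congr fun d => ?_
      rw [Formula.realize_inf, Formula.realize_iInf]
      refine and_congr (realize_relabel_of_comp ?_)
        (forall_congr' fun i => realize_relabel_of_comp ?_) <;> rintro (y | y) <;> rfl
    have hσ : σ.Realize (Sum.elim c Subtype.val) := Formula.realize_iInf.2 fun τ => τ.1.2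
    -- All Morley sequences of length `r` have the same type over `A`, so if `ρ` failed at `x`, then
    -- `∼ρ` would be a Morley formula. It would hold at some sequence inside `φ(x, c)`, where `c`
    -- itself witnesses `ρ`.
    have hxr : ρ.Realize (Sum.elim (Function.uncurry fun i : Fin r => x i) Subtype.val) := by
      by_contra hn
      have hmem : (∼ρ) ∈ MorleyFormula p A r := by
        intro y hy
        rw [Formula.realize_not]
        intro hρy
        apply hn
        have h1 := hi.realize_iff_of_isFinMorley r (c := (Empty.elim : Empty → M))
          (c' := Empty.elim) (fun ψ => Iff.rfl) (x := y) (x' := fun i : Fin r => x i)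
          (hy.mono (by simp [Set.range_eq_empty]))
          ((hx.isFinMorley r).mono (by simp [Set.range_eq_empty]))
          (ρ.relabel (Sum.map Sum.inr id))
        rwa [realize_relabel_of_comp (w := Sum.elim (Function.uncurry y) Subtype.val)
            (by rintro (y | y) <;> rfl),
          realize_relabel_of_comp
            (w := Sum.elim (Function.uncurry fun i : Fin r => x i) Subtype.val)
            (by rintro (y | y) <;> rfl), iff_true_left hρy] at h1
      obtain ⟨y, hy1, hy2⟩ := realize_exSeq.1 (H r _ hmem)
      exact Formula.realize_not.1 hy1 ((hρ y).2 ⟨c, hσ, hy2⟩)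
    obtain ⟨d, hd1, hd2⟩ := (hρ _).1 hxr
    refine ⟨d, ?_⟩
    rintro (τ | i) hs
    · exact (hF1 τ d).2 (Formula.realize_iInf.1 hd1 ⟨τ, Finset.mem_toLeft.2 hs⟩)
    · exact (hF2 i d).2 (hd2 ⟨i, hr i (Finset.mem_toRight.2 hs)⟩))
  have hd1 : Has p φ d := hp.has_of_forall hM hA hx fun i => (hF2 i d).1 (hd (Sum.inr i))
  refine h ((hi k φ c d (sameType_of_forall fun ψ hψ => ?_)).2 hd1)
  exact (hF1 ⟨ψ, hψ⟩ d).1 (hd (Sum.inl ⟨ψ, hψ⟩))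

theorem realize_exSeq_of_has (hM : IsMonster L M κ) {n : ℕ}
    {p : GlobalType L M (Fin n)} {A : Set M} (hA : #A < κ)
    {k : ℕ} {φ : L.Formula (Fin n ⊕ Fin k)} {c : Fin k → M} (h : Has p φ c) {r : ℕ}
    {π : L.Formula ((Fin r × Fin n) ⊕ A)} (hπ : π ∈ MorleyFormula p A r) :
    (exSeq π φ).Realize (Sum.elim c Subtype.val) := by
  obtain ⟨x, hx⟩ := hM.exists_isFinMorley p (hM.small_union_range hA c) r
  refine realize_exSeq.2 ⟨x, hπ x (hx.mono Set.subset_union_left), fun i => ?_⟩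
  exact hx.realizesOn i k φ c (fun z => Or.inr ⟨z, rfl⟩) h

/-- Generically stable types are definable, by a formula that bounds the length of the Morley
sequences inside a formula outside the type. -/
theorem exists_definition (hM : IsMonster L M κ) {n : ℕ}
    {p : GlobalType L M (Fin n)} {A : Set M} (hA : #A < κ) (hi : InvariantOver p A)
    (hp : StableSequences p A) {k : ℕ} (φ : L.Formula (Fin n ⊕ Fin k)) :
    ∃ d : L.Formula (Fin k ⊕ A),
      (∀ c, Has p φ c ↔ d.Realize (Sum.elim c Subtype.val)) ∧
      ∀ (N : Type u) [L.Structure N] (j : M ↪ₑ[L] N) (c : Fin k → N),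
        ¬ d.Realize (Sum.elim c (j ∘ Subtype.val)) →
        ∃ r, ∃ π ∈ MorleyFormula p A r,
          ¬ (exSeq π φ).Realize (Sum.elim c (j ∘ Subtype.val)) := by
  classical
  let I := Σ r, MorleyFormula p A r
  let F : I ⊕ I → L.Formula (Fin k ⊕ A) :=
    Sum.elim (fun i => exSeq i.2.1 φ) fun i => exSeq i.2.1 (∼φ)
  -- Each `c` leaves `φ` or `∼φ` outside `p`, so one of these formulas omits some Morley formula;
  -- saturation makes finitely many suffice.
  obtain ⟨s, hs⟩ : ∃ s : Finset (I ⊕ I), ∀ c : Fin k → M,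
      ∃ i ∈ s, ¬ (F i).Realize (Sum.elim c Subtype.val) := by
    by_contra! H
    obtain ⟨c, hc⟩ := hM.exists_forall_realize hA F H
    by_cases h : Has p φ c
    · obtain ⟨r, π, hπ, hn⟩ := exists_morleyFormula_of_not_has hM hA hi hp (φ := ∼φ) (c := c)
        fun h' => holds_not.1 h' h
      exact hn (hc (Sum.inr ⟨r, π, hπ⟩))
    · obtain ⟨r, π, hπ, hn⟩ := exists_morleyFormula_of_not_has hM hA hi hp h
      exact hn (hc (Sum.inl ⟨r, π, hπ⟩))
  -- The conjuncts about `φ` form the definition. In any extension its failure names a failing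
  -- conjunct, which is the bound on sequences.
  refine ⟨Formula.iInf fun i : s.toLeft => F (Sum.inl i.1), fun c => ⟨fun h => ?_, fun h => ?_⟩,
    fun N _ j c h => ?_⟩
  · exact Formula.realize_iInf.2 fun i => realize_exSeq_of_has hM hA h i.1.2.2
  · by_contra hn
    obtain ⟨i | i, his, hi⟩ := hs c
    · exact hi (Formula.realize_iInf.1 h ⟨i, Finset.mem_toLeft.2 his⟩)
    · exact hi (realize_exSeq_of_has hM hA (φ := ∼φ) (holds_not.2 hn) i.2.2)
  · rw [Formula.realize_iInf] at h
    push Not at h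
    obtain ⟨i, hi⟩ := h
    exact ⟨i.1.1, i.1.2.1, i.1.2.2, hi⟩

end Definability

/-! ### Canonical extensions, and semi-isolation from dependence. -/

section SemiIsolation

variable {L : FirstOrder.Language.{u, u}} {M : Type u} [L.Structure M] {α β γ : Type}
variable {κ : Cardinal.{u}}

/-- A copy of `c` in `M` over `A ∪ A'` serves both bases, so the definition over `A` computes the
extension formed over `A'`. -/
theorem IsMonster.extensionHas_iff (hM : IsMonster L M κ) {N : Type u} [L.Structure N]
    {j : M ↪ₑ[L] N} {p : GlobalType L M α} {A A' : Set M} (hA : #A < κ) (hA' : #A' < κ)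
    (hi' : InvariantOver p A') {k : ℕ} {φ : L.Formula (α ⊕ Fin k)} {d : L.Formula (Fin k ⊕ A)}
    (hd : ∀ c, Has p φ c ↔ d.Realize (Sum.elim c Subtype.val)) (c : Fin k → N) :
    ExtensionHas j p A' φ c ↔ d.Realize (Sum.elim c (j ∘ Subtype.val)) := by
  obtain ⟨c₁, hc₁⟩ := hM.exists_sameType j (hM.small_union hA hA') c
  have h1 : Has p φ c₁ ↔ d.Realize (Sum.elim c (j ∘ Subtype.val)) := by
    rw [hd, ← realize_map j]
    exact hc₁.realize_iff d fun x => Or.inl x.2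
  have h2 : SameType j A' (j ∘ c₁) c := hc₁.mono Set.subset_union_right
  rw [← h1]
  refine ⟨?_, fun h => ⟨c₁, h2, h⟩⟩
  rintro ⟨c₂, hc₂, h⟩
  refine (hi' k φ c₂ c₁ fun l ψ e he => ?_).1 h
  have h3 := (hc₂ l ψ e he).trans (h2 l ψ e he).symm
  rwa [realize_map, realize_map] at h3

/-- Definability of a generically stable type for formulas over `M`, and the finite
satisfiability in `M` of its canonical extension. -/
theorem exists_global_definition (hM : IsMonster L M κ) {n : ℕ}
    {p : GlobalType L M (Fin n)} {A : Set M} (hA : #A < κ) (hi : InvariantOver p A)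
    (hp : StableSequences p A) (ψ : L.Formula (Fin n ⊕ (β ⊕ M))) :
    ∃ d : L.Formula (β ⊕ M),
      (∀ c : β → M, Holds p ψ (Sum.elim c id) ↔ d.Realize (Sum.elim c id)) ∧
      (∀ (N : Type u) [L.Structure N] (j : M ↪ₑ[L] N) (a : Fin n → N) (b : β → N),
        RealizesOver j κ p b a →
          (ψ.Realize (Sum.elim a (Sum.elim b j)) ↔ d.Realize (Sum.elim b j))) ∧
      ∀ (N : Type u) [L.Structure N] (j : M ↪ₑ[L] N) (b : β → N), d.Realize (Sum.elim b j) →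
        ∃ a : Fin n → M, ψ.Realize (Sum.elim (j ∘ a) (Sum.elim b j)) := by
  obtain ⟨k, ψ₀, s, hs, hs'⟩ := exists_has_iff_holds (M := M) ψ
  obtain ⟨d, hd, -⟩ := exists_definition hM hA hi hp ψ₀
  have hd' : ∀ c, Has p (∼ψ₀) c ↔ Formula.Realize (∼d) (Sum.elim c Subtype.val) := fun c =>
    holds_not.trans ((not_congr (hd c)).trans Formula.realize_not.symm)
  have hdr : ∀ {N : Type u} [L.Structure N] (j : M → N) (b : β → N),
      (d.relabel (Sum.elim s (Sum.inr ∘ Subtype.val)) : L.Formula (β ⊕ M)).Realize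
        (Sum.elim b j) ↔ d.Realize (Sum.elim (Sum.elim b j ∘ s) (j ∘ Subtype.val)) :=
    fun j b => realize_relabel_of_comp (by rintro (y | y) <;> rfl)
  refine ⟨d.relabel (Sum.elim s (Sum.inr ∘ Subtype.val)), fun c => ?_, fun N _ j a b h => ?_,
    fun N _ j b h => ?_⟩
  · rw [← hs', hd, hdr, Function.id_comp]
  · obtain ⟨A', hA', hi', h⟩ := h
    have hc : ∀ i, (Sum.elim b j ∘ s) i ∈ Set.range j ∪ Set.range b := by
      intro i
      rcases hsi : s i with y | y
      · exact Or.inr ⟨y, by simp [hsi]⟩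
      · exact Or.inl ⟨y, by simp [hsi]⟩
    rw [hdr, ← hs]
    refine ⟨fun h1 => by_contra fun hn => ?_, fun h1 => ?_⟩
    · exact Formula.realize_not.1 (h k (∼ψ₀) _ hc
        ((hM.extensionHas_iff hA hA' hi' hd' _).2 (Formula.realize_not.2 hn))) h1
    · exact h k ψ₀ _ hc ((hM.extensionHas_iff hA hA' hi' hd _).2 h1)
  · rw [hdr] at h
    -- Since `∼ψ` is outside the extension, it excludes some Morley formula `π`. A Morley sequence
    -- in `M` satisfies `π`, so one of its terms satisfies `ψ`.
    obtain ⟨d₁, hd₁, hN⟩ := exists_definition hM hA hi hp (∼ψ₀)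
    obtain ⟨r, π, hπ, hr⟩ := hN N j (Sum.elim b j ∘ s) (by
      rw [← hM.extensionHas_iff hA hA hi hd₁, hM.extensionHas_iff hA hA hi hd']
      exact fun hn => Formula.realize_not.1 hn h)
    obtain ⟨x, hx⟩ := hM.exists_isFinMorley p hA r
    by_contra! H
    refine hr (realize_exSeq.2 ⟨fun i => j ∘ x i, ?_, fun i => ?_⟩)
    · exact (realize_map j π (Function.uncurry x) _).2 (hπ x hx)
    · rw [Formula.realize_not, hs]
      exact H (x i)

/-- Needed when the parameters are indexed by all of `M`, which need not be small: only those that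
occur must lie in the base. -/
theorem exists_finite_holds_iff {P : Type*} (ψ : L.Formula (α ⊕ P)) :
    ∃ T : Set P, T.Finite ∧ ∀ (p : GlobalType L M α) (e : P → M) (B : Set M) (a : α → M),
      RealizesOn p B a → (∀ t ∈ T, e t ∈ B) → (Holds p ψ e ↔ ψ.Realize (Sum.elim a e)) := by
  obtain ⟨k, ψ₀, s, hs, hs'⟩ := exists_has_iff_holds (M := M) ψ
  refine ⟨Set.range s, Set.finite_range s, fun p e B a h hT => ?_⟩
  rw [← hs, ← hs']
  exact h.holds_iff ψ₀ fun i => hT _ ⟨i, rfl⟩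

/-- The variables `x_0, …, x_r` split into the first one and the others. -/
def splitFirst {r : ℕ} {β P : Type*} (z : (β ⊕ (Fin (r + 1) × α)) ⊕ P) :
    ((β ⊕ α) ⊕ (Fin r × α)) ⊕ P :=
  Sum.map (Sum.elim (Sum.inl ∘ Sum.inl) fun z =>
    Fin.cases (Sum.inl (Sum.inr z.2)) (fun i => Sum.inr (i, z.2)) z.1) id z

theorem realize_splitFirst {r : ℕ} {β P N : Type*} [L.Structure N]
    {π : L.Formula ((β ⊕ (Fin (r + 1) × α)) ⊕ P)} {c : β → N} {x : Fin (r + 1) → α → N}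
    {e : P → N} :
    (π.relabel splitFirst).Realize
        (Sum.elim (Sum.elim (Sum.elim c (x 0)) (Function.uncurry (Fin.tail x))) e) ↔
      π.Realize (Sum.elim (Sum.elim c (Function.uncurry x)) e) := by
  refine realize_relabel_of_comp ?_
  rintro ((y | ⟨i, y⟩) | y)
  · rfl
  · refine Fin.cases ?_ (fun i => ?_) i <;> rfl
  · rfl

/-- The powers of a generically stable type are definable. -/
theorem exists_morley_definition (hM : IsMonster L M κ) {n : ℕ}
    {p : GlobalType L M (Fin n)} {A : Set M} (hA : #A < κ) (hi : InvariantOver p A)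
    (hp : StableSequences p A) (r : ℕ) :
    ∀ {β : Type} (π : L.Formula ((β ⊕ (Fin r × Fin n)) ⊕ M)),
    ∃ (B : Set M) (δ : L.Formula (β ⊕ M)), #B < κ ∧
      ∀ (c : β → M) (x : Fin r → Fin n → M), IsFinMorley p (B ∪ Set.range c) x →
        (π.Realize (Sum.elim (Sum.elim c (Function.uncurry x)) id) ↔
          δ.Realize (Sum.elim c id)) := by
  induction r with
  | zero =>
    intro β π
    refine ⟨A, π.relabel (Sum.map (Sum.elim id fun z => z.1.elim0) id), hA, fun c x _ => ?_⟩
    refine (realize_relabel_of_comp ?_).symm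
    rintro ((y | y) | y)
    exacts [rfl, y.1.elim0, rfl]
  | succ r ih =>
    intro β π
    -- With `x_0` counted among the parameters, the later terms are eliminated first; what remains
    -- is a condition on `x_0`, eliminated by the definition of `p`.
    obtain ⟨B, δ, hB, hδ⟩ := ih (π.relabel splitFirst)
    let ψ : L.Formula (Fin n ⊕ (β ⊕ M)) := δ.relabel
      (Sum.elim (Sum.elim (Sum.inr ∘ Sum.inl) Sum.inl) (Sum.inr ∘ Sum.inr))
    obtain ⟨d, hd, -, -⟩ := exists_global_definition hM hA hi hp ψ
    obtain ⟨T, hT, hTψ⟩ := exists_finite_holds_iff (M := M) ψ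
    have hT' : #(Sum.inr ⁻¹' T : Set M) < κ :=
      hM.small_of_countable ((hT.preimage Sum.inr_injective.injOn).countable)
    refine ⟨B ∪ Sum.inr ⁻¹' T, d, hM.small_union hB hT', fun c x hx => ?_⟩
    rw [← realize_splitFirst, hδ _ _ (hx.tail.mono ?_), ← hd, hTψ p _ _ _ (hx.realizesOn 0)]
    · refine (realize_relabel_of_comp ?_).symm
      rintro ((y | y) | y) <;> rfl
    · rintro (y | y) hy
      · exact Or.inr ⟨y, rfl⟩
      · exact Or.inl (Or.inr hy)
    · rw [Set.Sum.elim_range]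
      rintro m (hm | hm | hm)
      · exact Or.inl (Or.inl (Or.inl hm))
      · exact Or.inl (Or.inr hm)
      · exact Or.inr hm

/-- A tuple realizing `p` but not its canonical extension to `M b` satisfies a formula over `M b`
that contains no long Morley sequence. -/
theorem exists_of_not_realizesOver (hM : IsMonster L M κ) {n : ℕ}
    {p : GlobalType L M (Fin n)} {A : Set M} (hA : #A < κ) (hi : InvariantOver p A)
    (hp : StableSequences p A) {N : Type u} [L.Structure N] {j : M ↪ₑ[L] N} {a : Fin n → N}
    {b : β → N} (h : ¬ RealizesOver j κ p b a) :
    ∃ (k : ℕ) (θ : L.Formula (Fin n ⊕ Fin k)) (t : Fin k → β ⊕ M) (d : L.Formula (Fin k ⊕ A)),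
      (∀ c, Has p θ c ↔ d.Realize (Sum.elim c Subtype.val)) ∧
      θ.Realize (Sum.elim a (Sum.elim b j ∘ t)) ∧
      ¬ d.Realize (Sum.elim (Sum.elim b j ∘ t) (j ∘ Subtype.val)) ∧
      ∃ r, ∃ π ∈ MorleyFormula p A r,
        ¬ (exSeq π θ).Realize (Sum.elim (Sum.elim b j ∘ t) (j ∘ Subtype.val)) := by
  have h1 : ¬ ∀ (k : ℕ) (φ : L.Formula (Fin n ⊕ Fin k)) (c : Fin k → N),
      (∀ i, c i ∈ Set.range j ∪ Set.range b) →
      ExtensionHas j p A φ c → φ.Realize (Sum.elim a c) := fun h' => h ⟨A, hA, hi, h'⟩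
  push Not at h1
  obtain ⟨k, φ, c, hc, hφ, hn⟩ := h1
  have : ∀ i, ∃ y : β ⊕ M, Sum.elim b j y = c i := by
    intro i
    rcases hc i with ⟨y, hy⟩ | ⟨y, hy⟩
    · exact ⟨Sum.inr y, hy⟩
    · exact ⟨Sum.inl y, hy⟩
  choose t ht using this
  obtain rfl : Sum.elim b j ∘ t = c := funext ht
  -- `∼φ` is the formula that `a` satisfies although it is outside the extension, so it is the one
  -- whose sequences must be bounded.
  obtain ⟨d, hd, hN⟩ := exists_definition hM hA hi hp (∼φ)
  have hd' : ∀ c, Has p φ c ↔ Formula.Realize (∼d) (Sum.elim c Subtype.val) := fun c => by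
    rw [Formula.realize_not, ← hd]
    exact (not_iff_comm.1 (holds_not (p := p) (φ := φ) (e := c)).symm).symm
  have hnd : ¬ d.Realize (Sum.elim (Sum.elim b j ∘ t) (j ∘ Subtype.val)) :=
    Formula.realize_not.1 ((hM.extensionHas_iff hA hA hi hd' _).1 hφ)
  exact ⟨k, ∼φ, t, d, hd, Formula.realize_not.2 hn, hnd, hN N j _ hnd⟩

theorem semiIsolatedBy_of_formula {N : Type u} [L.Structure N] {j : M ↪ₑ[L] N}
    {p : GlobalType L M α} {a : α → N} {b : β → N} (ha : Realizes j p a)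
    (ψ : L.Formula ((α ⊕ β) ⊕ M)) (h : ψ.Realize (Sum.elim (Sum.elim a b) j))
    (h' : ∀ a', ψ.Realize (Sum.elim (Sum.elim a' b) j) → Realizes j p a') :
    SemiIsolatedBy j a b := by
  obtain ⟨k, ψ₀, s, hs⟩ := exists_finite_parameters ψ
  refine ⟨k, ψ₀, s, (hs N _ _).2 h, fun a' ha' l χ d _ => ?_⟩
  rw [← h' a' ((hs N _ _).1 ha') l χ d, ha l χ d]

theorem not_realizes_iff {N : Type u} [L.Structure N] {j : M ↪ₑ[L] N}
    {p : GlobalType L M α} {a : α → N} : ¬ Realizes j p a ↔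
      ∃ (k : ℕ) (φ : L.Formula (α ⊕ Fin k)) (c : Fin k → M),
        Has p φ c ∧ ¬ φ.Realize (Sum.elim a (j ∘ c)) := by
  refine ⟨fun h => ?_, fun ⟨k, φ, c, h1, h2⟩ h => h2 ((h k φ c).1 h1)⟩
  unfold Realizes at h
  push Not at h
  obtain ⟨k, φ, c, h | h⟩ := h
  · exact ⟨k, φ, c, h⟩
  · exact ⟨k, ∼φ, c, holds_not.2 h.1, fun hn => Formula.realize_not.1 hn h.2⟩

/-- Formulas over `M` true at the Morley sequences of length `r` in `p` over some small set. -/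
def GlobalMorleyFormula (κ : Cardinal.{u}) (p : GlobalType L M α) (r : ℕ) :
    Set (L.Formula ((Fin r × α) ⊕ M)) :=
  {π | ∃ B : Set M, #B < κ ∧ ∀ x : Fin r → α → M, IsFinMorley p B x →
    π.Realize (Sum.elim (Function.uncurry x) id)}

/-- Strong regularity of `(p, φ(x, c))` over the set `A`. -/
def RegularOver (κ : Cardinal.{u}) (p : GlobalType L M α) (A : Set M) {k : ℕ}
    (φ : L.Formula (α ⊕ Fin k)) (c : Fin k → M) : Prop :=
  Has p φ c ∧ ∀ B : Set M, A ⊆ B → #B < κ → ∀ a : α → M, φ.Realize (Sum.elim a c) →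
    RealizesOn p B a ∨ ∀ x : α → M, RealizesOn p B x → RealizesOn p (B ∪ Set.range a) x

theorem RegularOver.mono {p : GlobalType L M α} {A A' : Set M} (hA : A ⊆ A') {k : ℕ}
    {φ : L.Formula (α ⊕ Fin k)} {c : Fin k → M} (h : RegularOver κ p A φ c) :
    RegularOver κ p A' φ c :=
  ⟨h.1, fun B hB => h.2 B (hA.trans hB)⟩

/-- The regularity dichotomy applies over `B` with the earlier terms added; failing `p` on `B`, `a`
fails it there too, so each term stays generic after adding `a`. -/
theorem RegularOver.isFinMorley (hM : IsMonster L M κ) {n : ℕ} {p : GlobalType L M (Fin n)}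
    {A : Set M} {k : ℕ} {φ : L.Formula (Fin n ⊕ Fin k)} {c : Fin k → M}
    (h : RegularOver κ p A φ c) {B : Set M} (hAB : A ⊆ B) (hB : #B < κ) {a : Fin n → M}
    (ha : φ.Realize (Sum.elim a c)) (hn : ¬ RealizesOn p B a) {r : ℕ} {x : Fin r → Fin n → M}
    (hx : IsFinMorley p B x) : IsFinMorley p (B ∪ Set.range a) x := by
  intro i
  have hs : #(B ∪ {m | ∃ l < i, m ∈ Set.range (x l)} : Set M) < κ := by
    refine hM.small_union hB (hM.small_of_countable
      ((Set.countable_range (Function.uncurry x)).mono ?_))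
    rintro m ⟨l, -, t, rfl⟩
    exact ⟨(l, t), rfl⟩
  rcases h.2 _ (hAB.trans Set.subset_union_left) hs a ha with h1 | h1
  · exact absurd (h1.mono Set.subset_union_left) hn
  · rw [Set.union_right_comm]
    exact h1 _ (hx i)

/-- If `a` realizes a generically stable, strongly regular type `p`, but not its canonical
extension to `M b`, then `b` semi-isolates `a` over `M`. -/
theorem semiIsolatedBy_of_not_realizesOver (hM : IsMonster L M κ) {n : ℕ}
    {p : GlobalType L M (Fin n)} {A : Set M} (hA : #A < κ) (hi : InvariantOver p A)
    (hp : StableSequences p A) {k₀ : ℕ} {φ : L.Formula (Fin n ⊕ Fin k₀)} {c₀ : Fin k₀ → M}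
    (hr : RegularOver κ p A φ c₀) {N : Type u} [L.Structure N] {j : M ↪ₑ[L] N} {a : Fin n → N}
    {b : β → N} (ha : Realizes j p a) (h : ¬ RealizesOver j κ p b a) :
    SemiIsolatedBy j a b := by
  obtain ⟨k, θ, t, -, -, hθ, -, r₀, π₀, hπ₀, hr₀⟩ :=
    exists_of_not_realizesOver hM hA hi hp h
  set c : Fin k → N := Sum.elim b j ∘ t with hc
  -- Length `0` always works and length `r₀` does not, so there is a last good `r` before a failure.
  obtain ⟨r, h1, h2⟩ : ∃ r, (∀ π ∈ GlobalMorleyFormula κ p r,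
      (exSeq π θ).Realize (Sum.elim c j)) ∧
      ¬ ∀ π ∈ GlobalMorleyFormula κ p (r + 1), (exSeq π θ).Realize (Sum.elim c j) := by
    by_contra! H
    have hall : ∀ r, ∀ π ∈ GlobalMorleyFormula κ p r, (exSeq π θ).Realize (Sum.elim c j) := by
      intro r
      induction r with
      | zero =>
        rintro π ⟨B, -, hB⟩
        refine realize_exSeq.2 ⟨fun i => i.elim0, ?_, fun i => i.elim0⟩
        have := (realize_map j π _ _).2 (hB (fun i => i.elim0) fun i => i.elim0)
        rw [Function.comp_id] at this
        convert this using 2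
        ext ⟨i, -⟩
        exact i.elim0
      | succ r ih => exact H r ih
    refine hr₀ ?_
    have hval : ∀ {N : Type u} [L.Structure N] (j : M → N) (x : Fin r₀ → Fin n → N),
        (π₀.relabel (Sum.map id Subtype.val) : L.Formula ((Fin r₀ × Fin n) ⊕ M)).Realize
          (Sum.elim (Function.uncurry x) j) ↔
        π₀.Realize (Sum.elim (Function.uncurry x) (j ∘ Subtype.val)) := fun j x =>
      realize_relabel_of_comp (by rintro (y | y) <;> rfl)
    obtain ⟨x, hx, hx'⟩ := realize_exSeq.1 (hall r₀ (π₀.relabel (Sum.map id Subtype.val))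
      ⟨A, hA, fun x hx => (hval id x).2 (hπ₀ x hx)⟩)
    exact realize_exSeq.2 ⟨x, (hval j x).1 hx, hx'⟩
  push Not at h2
  obtain ⟨π, ⟨B₁, hB₁, hπ⟩, hπθ⟩ := h2
  let π₁ : L.Formula ((Fin n ⊕ (Fin r × Fin n)) ⊕ M) := π.relabel (Sum.map (fun z =>
    Fin.cases (Sum.inl z.2) (fun i => Sum.inr (i, z.2)) z.1) id)
  have hπ₁ : ∀ {N : Type u} [L.Structure N] (j : M → N) (y : Fin n → N)
      (x : Fin r → Fin n → N), π₁.Realize (Sum.elim (Sum.elim y (Function.uncurry x)) j) ↔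
        π.Realize (Sum.elim (Function.uncurry (Fin.cons y x : Fin (r + 1) → Fin n → N)) j) := by
    intro N _ j y x
    refine realize_relabel_of_comp ?_
    rintro (⟨i, y⟩ | y)
    · refine Fin.cases ?_ (fun i => ?_) i <;> rfl
    · rfl
  -- `δ(y)` says that `π(y, x)` holds for an `r`-sequence `x` generic over `B₂` and `y`. It belongs
  -- to `p` because `y` followed by `x` is Morley when `y` is generic.
  obtain ⟨B₂, δ, hB₂, hδ⟩ := exists_morley_definition hM hA hi hp r π₁
  have hδp : Holds p δ id := by
    obtain ⟨T, hT, hTδ⟩ := exists_finite_holds_iff (M := M) δ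
    obtain ⟨x, hx⟩ := hM.exists_isFinMorley p (hM.small_union (hM.small_union hB₁ hB₂)
      (hM.small_of_countable hT.countable)) (r + 1)
    rw [hTδ p id _ _ (hx.realizesOn 0) fun t ht => Or.inr ht,
      ← hδ (x 0) (Fin.tail x) (hx.tail.mono ?_), hπ₁, Fin.cons_self_tail]
    · exact hπ x (hx.mono fun m hm => Or.inl (Or.inl hm))
    · exact Set.union_subset_union_left _ fun m hm => Or.inl (Or.inr hm)
  let ψ : L.Formula ((Fin n ⊕ β) ⊕ M) :=
    (θ.relabel (Sum.elim (Sum.inl ∘ Sum.inl) fun i => Sum.map Sum.inr id (t i)) ⊓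
      φ.relabel (Sum.map Sum.inl c₀)) ⊓ δ.relabel (Sum.map Sum.inl id)
  have hψ : ∀ y : Fin n → N, ψ.Realize (Sum.elim (Sum.elim y b) j) ↔
      (θ.Realize (Sum.elim y c) ∧ φ.Realize (Sum.elim y (j ∘ c₀))) ∧
        δ.Realize (Sum.elim y j) := by
    intro y
    rw [Formula.realize_inf, Formula.realize_inf]
    refine and_congr (and_congr (realize_relabel_of_comp ?_) (realize_relabel_of_comp ?_))
      (realize_relabel_of_comp ?_)
    · rintro (z | z)
      · rfl
      · rw [hc]
        rcases hz : t z with w | w <;> simp [hz]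
    · rintro (z | z) <;> rfl
    · rintro (z | z) <;> rfl
  refine semiIsolatedBy_of_formula ha ψ ((hψ a).2 ⟨⟨hθ, (ha _ _ _).1 hr.1⟩, ?_⟩) fun a' ha' => ?_
  · exact (ha.holds_iff δ id).1 hδp
  · obtain ⟨⟨ha1, ha2⟩, ha3⟩ := (hψ a').1 ha'
    by_contra hn
    obtain ⟨l, χ, e, hχ, hχa⟩ := not_realizes_iff.1 hn
    -- `ω(x)` says that each `y` satisfying `φ`, `∼χ` and `δ` also satisfies `π(y, x)`.
    let ω : L.Formula ((Fin r × Fin n) ⊕ M) :=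
      ∼(ex ((φ.relabel (Sum.map Sum.inr c₀) ⊓ ∼(χ.relabel (Sum.map Sum.inr e))) ⊓
        (δ.relabel (Sum.map Sum.inr id) ⊓ ∼(π₁.relabel (Sum.map Sum.swap id)))))
    have hω : ∀ {N : Type u} [L.Structure N] (j : M → N) (x : Fin r → Fin n → N),
        ω.Realize (Sum.elim (Function.uncurry x) j) ↔ ¬ ∃ y : Fin n → N,
          (φ.Realize (Sum.elim y (j ∘ c₀)) ∧ ¬ χ.Realize (Sum.elim y (j ∘ e))) ∧
          (δ.Realize (Sum.elim y j) ∧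
            ¬ π₁.Realize (Sum.elim (Sum.elim y (Function.uncurry x)) j)) := by
      intro N _ j x
      rw [Formula.realize_not, realize_ex]
      refine not_congr (exists_congr fun y => ?_)
      simp only [Formula.realize_inf, Formula.realize_not]
      refine and_congr (and_congr (realize_relabel_of_comp ?_)
        (not_congr (realize_relabel_of_comp ?_))) (and_congr (realize_relabel_of_comp ?_)
          (not_congr (realize_relabel_of_comp ?_)))
      · rintro (z | z) <;> rfl
      · rintro (z | z) <;> rfl
      · rintro (z | z) <;> rfl
      · rintro ((z | z) | z) <;> rfl
    have hmem : ω ∈ GlobalMorleyFormula κ p r := by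
      -- With `e` in the base, failing `χ` means not realizing `p` on `B`; regularity then keeps `x`
      -- Morley over `B` and `y`, and `δ(y)` yields `π(y, x)`.
      let B : Set M := (A ∪ B₂) ∪ Set.range e
      have hB : #B < κ := hM.small_union_range (hM.small_union hA hB₂) e
      refine ⟨B, hB, fun x hx => (hω id x).2 ?_⟩
      rintro ⟨y, ⟨hy1, hy2⟩, hy3, hy4⟩
      have hyB : ¬ RealizesOn p B y := fun hy =>
        hy2 (hy l χ e (fun i => Or.inr ⟨i, rfl⟩) hχ)
      have hxy := hr.isFinMorley hM (fun m hm => Or.inl (Or.inl hm)) hB hy1 hyB hx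
      refine hy4 ((hδ y x (hxy.mono (Set.union_subset_union_left _ ?_))).2 hy3)
      exact fun m hm => Or.inl (Or.inr hm)
    -- Some `r`-sequence inside `θ` satisfies `ω`; prepending `a'` gives a sequence that the choice
    -- of `π` forbids.
    obtain ⟨x, hx, hxθ⟩ := realize_exSeq.1 (h1 ω hmem)
    have hxa : π₁.Realize (Sum.elim (Sum.elim a' (Function.uncurry x)) j) := by
      by_contra hna
      exact (hω j x).1 hx ⟨a', ⟨ha2, hχa⟩, ha3, hna⟩
    refine hπθ (realize_exSeq.2 ⟨Fin.cons a' x, (hπ₁ j a' x).1 hxa, fun i => ?_⟩)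
    refine Fin.cases ?_ (fun i => ?_) i
    · exact ha1
    · exact hxθ i

end SemiIsolation

/-! ### Orthogonality, symmetry of dependence and the Rudin–Keisler order. -/

section RudinKeisler

variable {L : FirstOrder.Language.{u, u}} {M : Type u} [L.Structure M] {α β γ : Type}
variable {κ : Cardinal.{u}}

/-- Otherwise `x = a`, which has a single solution, would belong to `p`. -/
theorem NonAlgebraic.not_realizes [Finite α] {p : GlobalType L M α} (hp : NonAlgebraic p)
    {N : Type u} [L.Structure N] {j : M ↪ₑ[L] N} (a : α → M) : ¬ Realizes j p (j ∘ a) := by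
  intro h
  let φ : L.Formula (α ⊕ α) := Formula.iInf fun i =>
    Term.equal (Term.var (Sum.inl i)) (Term.var (Sum.inr i))
  have hφ : ∀ {N : Type u} [L.Structure N] (v w : α → N),
      φ.Realize (Sum.elim v w) ↔ v = w := by
    intro N _ v w
    rw [Formula.realize_iInf, funext_iff]
    exact forall_congr' fun i => by simp [Formula.realize_equal]
  obtain ⟨k, φ₀, s, hs, hs'⟩ := exists_has_iff_holds (M := M) φ
  refine hp k φ₀ (a ∘ s) ((hs' p a).2 ((h.holds_iff φ a).2 ((hφ _ _).2 rfl))) ?_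
  refine (Set.finite_singleton a).subset fun v hv => ?_
  exact (hφ v a).1 ((hs M v a).1 hv)

theorem NonAlgebraic.nonempty {n : ℕ} {p : GlobalType L M (Fin n)} (hp : NonAlgebraic p) :
    Nonempty M := by
  by_contra hne
  rw [not_nonempty_iff] at hne
  obtain ⟨N, _, j, a, ha⟩ := exists_realizes p
  have h := hp 0 ⊤ Fin.elim0 ((ha 0 ⊤ Fin.elim0).2 (Formula.realize_top.2 trivial))
  exact h (Set.toFinite _)

theorem SameType.realizes {p : GlobalType L M α} {N : Type u} [L.Structure N] {j : M ↪ₑ[L] N}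
    {a a' : α → N} (h : SameType j Set.univ a' a) (ha : Realizes j p a) : Realizes j p a' :=
  fun k φ c => (ha k φ c).trans (h k φ c fun _ => Set.mem_univ _).symm

/-- The global type of a tuple in an elementary extension. -/
theorem exists_globalType_of_tuple [Nonempty M] [Finite γ] {N : Type u} [L.Structure N]
    (j : M ↪ₑ[L] N) (v : γ → N) : ∃ r : GlobalType L M γ, Realizes j r v := by
  obtain ⟨r, hr⟩ := exists_globalType {φ : L.Formula (γ ⊕ M) | φ.Realize (Sum.elim v j)}
    fun Γ₀ h => exists_forall_realize_of_realize j Γ₀.finite_toSet (e := id) (v := v)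
      fun φ hφ => h hφ
  refine ⟨r, fun k φ c => ?_⟩
  have key : ∀ ψ : L.Formula (γ ⊕ Fin k), ψ.Realize (Sum.elim v (j ∘ c)) → Has r ψ c := by
    intro ψ hψ
    refine (holds_congr fun N' _ j' a' => ?_).1 (hr (ψ.relabel (Sum.map id c)) ?_)
    · exact realize_relabel_of_comp (by rintro (y | y) <;> rfl)
    · exact (realize_relabel_of_comp (by rintro (y | y) <;> rfl)).2 hψ
  refine ⟨fun h => by_contra fun hn => ?_, key φ⟩
  exact holds_not.1 (key (∼φ) (Formula.realize_not.2 hn)) h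

/-- `r(x, y)` extends `p(x) ∪ q(y)`. -/
def Extends (r : GlobalType L M (α ⊕ β)) (p : GlobalType L M α) (q : GlobalType L M β) : Prop :=
  (∀ (k : ℕ) (φ : L.Formula (α ⊕ Fin k)) (c : Fin k → M),
    Has p φ c → Has r (Formula.relabel (Sum.map Sum.inl id) φ) c) ∧
  (∀ (k : ℕ) (φ : L.Formula (β ⊕ Fin k)) (c : Fin k → M),
    Has q φ c → Has r (Formula.relabel (Sum.map Sum.inr id) φ) c)

theorem Realizes.extends_iff {r : GlobalType L M (α ⊕ β)} {p : GlobalType L M α}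
    {q : GlobalType L M β} {N : Type u} [L.Structure N] {j : M ↪ₑ[L] N} {v : α ⊕ β → N}
    (hv : Realizes j r v) :
    Extends r p q ↔ Realizes j p (v ∘ Sum.inl) ∧ Realizes j q (v ∘ Sum.inr) := by
  have e1 : ∀ (k : ℕ) (φ : L.Formula (α ⊕ Fin k)) (c : Fin k → M),
      Has r (Formula.relabel (Sum.map Sum.inl id) φ) c ↔
        φ.Realize (Sum.elim (v ∘ Sum.inl) (j ∘ c)) := fun k φ c =>
    (hv _ _ _).trans (realize_relabel_of_comp (by rintro (y | y) <;> rfl))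
  have e2 : ∀ (k : ℕ) (φ : L.Formula (β ⊕ Fin k)) (c : Fin k → M),
      Has r (Formula.relabel (Sum.map Sum.inr id) φ) c ↔
        φ.Realize (Sum.elim (v ∘ Sum.inr) (j ∘ c)) := fun k φ c =>
    (hv _ _ _).trans (realize_relabel_of_comp (by rintro (y | y) <;> rfl))
  constructor
  · rintro ⟨h1, h2⟩
    constructor <;> by_contra hn <;> obtain ⟨k, φ, c, h, h'⟩ := not_realizes_iff.1 hn
    · exact h' ((e1 k φ c).1 (h1 k φ c h))
    · exact h' ((e2 k φ c).1 (h2 k φ c h))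
  · rintro ⟨h1, h2⟩
    exact ⟨fun k φ c h => (e1 k φ c).2 ((h1 k φ c).1 h),
      fun k φ c h => (e2 k φ c).2 ((h2 k φ c).1 h)⟩

/-- Given a realization `b` of `q`, the union `p(x) ∪ q(y)` extends to a global type whose
formulas `φ(x, b)` are all satisfiable in `M`. -/
theorem exists_coheir_extension [Nonempty M] [Finite α] [Finite β] (p : GlobalType L M α)
    {q : GlobalType L M β} {N : Type u} [L.Structure N] {j : M ↪ₑ[L] N} {b : β → N}
    (hb : Realizes j q b) :
    ∃ r : GlobalType L M (α ⊕ β), Extends r p q ∧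
      ∀ (k : ℕ) (φ : L.Formula ((α ⊕ β) ⊕ Fin k)) (c : Fin k → M), Has r φ c →
        ∃ a : α → M, φ.Realize (Sum.elim (Sum.elim (j ∘ a) b) (j ∘ c)) := by
  obtain ⟨N₁, _, j₁, a₁, ha₁⟩ := exists_realizes p
  let Γ₁ : Set (L.Formula (α ⊕ M)) := {φ | Holds p φ id}
  -- A completion containing all formulas true at every `(a, b)` with `a` in `M` omits each formula
  -- with no solution `a` in `M`. This set also contains `q(y)`.
  let Γ₂ : Set (L.Formula ((α ⊕ β) ⊕ M)) :=
    {φ | ∀ a : α → M, φ.Realize (Sum.elim (Sum.elim (j ∘ a) b) j)}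
  let f : L.Formula (α ⊕ M) → L.Formula ((α ⊕ β) ⊕ M) := Formula.relabel (Sum.map Sum.inl id)
  obtain ⟨r, hr⟩ := exists_globalType (f '' Γ₁ ∪ Γ₂) (by
    intro Γ₀ hΓ₀
    have h1 : ((Γ₀ : Set (L.Formula ((α ⊕ β) ⊕ M))) ∩ f '' Γ₁).Finite :=
      Γ₀.finite_toSet.subset Set.inter_subset_left
    obtain ⟨Γ, h2, h3, h4⟩ := Set.exists_subset_image_finite_and.1
      ⟨_, Set.inter_subset_right, h1, rfl⟩
    obtain ⟨a, ha⟩ := exists_forall_realize_of_realize j₁ h3 (e := id) (v := a₁)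
      fun φ hφ => (ha₁.holds_iff φ id).1 (h2 hφ)
    refine exists_forall_realize_of_realize j Γ₀.finite_toSet (e := id)
      (v := Sum.elim (j ∘ a) b) fun φ hφ => ?_
    rcases hΓ₀ hφ with h | h
    · obtain ⟨φ, hφ', rfl⟩ : φ ∈ f '' Γ := h4 ▸ ⟨hφ, h⟩
      refine (realize_relabel_of_comp ?_).2 ((realize_map j φ a id).2 (ha φ hφ'))
      rintro (y | y) <;> rfl
    · exact h a)
  have key : ∀ (k : ℕ) (φ : L.Formula ((α ⊕ β) ⊕ Fin k)) (c : Fin k → M),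
      φ.relabel (Sum.map id c) ∈ f '' Γ₁ ∪ Γ₂ → Has r φ c := by
    intro k φ c h
    refine (holds_congr fun N' _ j' a' => ?_).1 (hr _ h)
    exact realize_relabel_of_comp (by rintro (y | y) <;> rfl)
  have hall : ∀ (k : ℕ) (φ : L.Formula ((α ⊕ β) ⊕ Fin k)) (c : Fin k → M),
      (∀ a : α → M, φ.Realize (Sum.elim (Sum.elim (j ∘ a) b) (j ∘ c))) → Has r φ c := by
    refine fun k φ c h => key k φ c (Or.inr fun a => (realize_relabel_of_comp ?_).2 (h a))
    rintro (y | y) <;> rfl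
  refine ⟨r, ⟨fun k φ c h => ?_, fun k φ c h => hall k _ c fun a => ?_⟩, fun k φ c h => ?_⟩
  · have h1 : Holds p (φ.relabel (Sum.map id c)) id := by
      refine (holds_congr fun N' _ j' a' => ?_).1 h
      exact (realize_relabel_of_comp (by rintro (y | y) <;> rfl)).symm
    refine (holds_congr fun N' _ j' a' => ?_).1 (hr _ (Or.inl ⟨_, h1, rfl⟩))
    refine (realize_relabel_of_comp (w := Sum.elim (a' ∘ Sum.inl) j') ?_).trans
      ((realize_relabel_of_comp (w := Sum.elim (a' ∘ Sum.inl) (j' ∘ c)) ?_).trans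
        (realize_relabel_of_comp ?_).symm) <;> rintro (y | y) <;> rfl
  · refine (realize_relabel_of_comp ?_).2 ((hb k φ c).1 h)
    rintro (y | y) <;> rfl
  · by_contra! hn
    exact holds_not.1 (hall k (∼φ) c fun a => Formula.realize_not.2 (hn a)) h

/-- A non-algebraic type is not orthogonal to the types above it in the Rudin–Keisler order. -/
theorem RKLe.not_orthogonal [Nonempty M] [Finite α] [Finite β] {p : GlobalType L M α}
    (hp : NonAlgebraic p) {q : GlobalType L M β} (h : RKLe p q) : ¬ Orthogonal p q := by
  obtain ⟨N, _, j, a, b, ha, hb, k, φ, d, hφ, hsem⟩ := h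
  rintro ⟨r₀, -, hr₀⟩
  obtain ⟨r, hr, hcoh⟩ := exists_coheir_extension p hb
  obtain ⟨r', hr'⟩ := exists_globalType_of_tuple j (Sum.elim a b)
  have hext : Extends r' p q := hr'.extends_iff.2 ⟨ha, hb⟩
  obtain rfl : r = r' := (hr₀ r hr).trans (hr₀ r' hext).symm
  -- Orthogonality identifies `tp(a, b / M)` with the coheir completion, so the semi-isolating
  -- formula has a solution in `M`, which then realizes `p`.
  obtain ⟨a', ha'⟩ := hcoh k φ d ((hr' k φ d).2 hφ)
  exact hp.not_realizes a' ((hsem _ ha').realizes ha)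

/-- If `p` is definable and `p(x) ∪ q(y)` is not complete, some realizations `a` of `p` and `b`
of `q` are such that `a` does not realize the canonical extension of `p` to `M b`. -/
theorem exists_not_realizesOver_of_not_orthogonal (hM : IsMonster L M κ) [Nonempty M] {n m : ℕ}
    {p : GlobalType L M (Fin n)} {A : Set M} (hA : #A < κ) (hi : InvariantOver p A)
    (hp : StableSequences p A) {q : GlobalType L M (Fin m)} (h : ¬ Orthogonal p q) :
    ∃ (N : Type u) (_ : L.Structure N) (j : M ↪ₑ[L] N) (a : Fin n → N) (b : Fin m → N),
      Realizes j p a ∧ Realizes j q b ∧ ¬ RealizesOver j κ p b a := by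
  by_contra! H
  obtain ⟨N₀, _, j₀, b₀, hb₀⟩ := exists_realizes q
  obtain ⟨r₀, hr₀, -⟩ := exists_coheir_extension p hb₀
  refine h ⟨r₀, hr₀, fun r hr => globalType_ext fun k φ c => ?_⟩
  let ψ : L.Formula (Fin n ⊕ (Fin m ⊕ M)) := φ.relabel
    (Sum.elim (Sum.map id Sum.inl) (Sum.inr ∘ Sum.inr ∘ c))
  obtain ⟨d, -, hd, -⟩ := exists_global_definition hM hA hi hp ψ
  -- If no pair is dependent, `φ(a, b)` is equivalent to `d(b)`, which `q` alone decides.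
  have key : ∀ r : GlobalType L M (Fin n ⊕ Fin m), Extends r p q →
      (Has r φ c ↔ Holds q d id) := by
    intro r hr
    obtain ⟨N, _, j, v, hv⟩ := exists_realizes r
    obtain ⟨h1, h2⟩ := hv.extends_iff.1 hr
    rw [hv k φ c, h2.holds_iff d id, Function.comp_id,
      ← hd N j _ _ (H N _ j _ _ h1 h2)]
    exact (realize_relabel_of_comp (by rintro ((y | y) | y) <;> rfl)).symm
  rw [key r hr, key r₀ hr₀]

/-- If `b` is semi-isolated by `a` and realizes a non-algebraic type, then `a` does not realize
the canonical extension of its type to `M b`. -/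
theorem not_realizesOver_of_semiIsolatedBy (hM : IsMonster L M κ) {n m : ℕ}
    {p : GlobalType L M (Fin n)} {A : Set M} (hA : #A < κ) (hi : InvariantOver p A)
    (hp : StableSequences p A) {q : GlobalType L M (Fin m)} (hq : NonAlgebraic q)
    {N : Type u} [L.Structure N] {j : M ↪ₑ[L] N} {a : Fin n → N} {b : Fin m → N}
    (ha : Realizes j p a) (hb : Realizes j q b) (h : SemiIsolatedBy j b a) :
    ¬ RealizesOver j κ p b a := by
  intro hab
  obtain ⟨k, φ, e, hφ, hsem⟩ := h
  let ψ : L.Formula (Fin n ⊕ (Fin m ⊕ M)) := φ.relabel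
    (Sum.elim (Sum.elim (Sum.inr ∘ Sum.inl) Sum.inl) (Sum.inr ∘ Sum.inr ∘ e))
  have hψ : ∀ b' : Fin m → N, ψ.Realize (Sum.elim a (Sum.elim b' j)) ↔
      φ.Realize (Sum.elim (Sum.elim b' a) (j ∘ e)) := fun b' =>
    realize_relabel_of_comp (by rintro ((y | y) | y) <;> rfl)
  obtain ⟨d, hd, hdN, -⟩ := exists_global_definition hM hA hi hp ψ
  -- If `a` is independent from `b`, then `d(b)` holds, so `d` has a solution `b'` in `M`. For it
  -- `φ(b', a)` holds, and `b'` realizes `q`.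
  obtain ⟨b', hb'⟩ := exists_realize_of_realize j (e := id)
    ((hdN N j a b hab).1 ((hψ b).2 hφ))
  have h1 : ψ.Realize (Sum.elim a (Sum.elim (j ∘ b') j)) := by
    have h2 := (ha.holds_iff ψ _).1 ((hd b').2 hb')
    rwa [Sum.comp_elim, Function.comp_id] at h2
  exact hq.not_realizes b' ((hsem _ ((hψ _).1 h1)).realizes hb)

/-- Symmetry of the canonical extensions. -/
theorem not_realizesOver_symm (hM : IsMonster L M κ) {n m : ℕ}
    {p : GlobalType L M (Fin n)} {A : Set M} (hA : #A < κ) (hi : InvariantOver p A)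
    (hp : StableSequences p A) {q : GlobalType L M (Fin m)} {A' : Set M} (hA' : #A' < κ)
    (hi' : InvariantOver q A') (hq : StableSequences q A')
    {N : Type u} [L.Structure N] {j : M ↪ₑ[L] N} {a : Fin n → N} {b : Fin m → N}
    (ha : Realizes j p a) (h : ¬ RealizesOver j κ p b a) : ¬ RealizesOver j κ q a b := by
  intro hba
  obtain ⟨k, θ, t, d, hd, hθ, hnd, -⟩ := exists_of_not_realizesOver hM hA hi hp h
  let τ : Fin m ⊕ M → Fin m ⊕ (Fin n ⊕ M) := Sum.map id Sum.inr
  let χ : L.Formula (Fin m ⊕ (Fin n ⊕ M)) :=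
    θ.relabel (Sum.elim (Sum.inr ∘ Sum.inl) (τ ∘ t)) ⊓
      ∼(d.relabel (Sum.elim (τ ∘ t) (Sum.inr ∘ Sum.inr ∘ Subtype.val)))
  have hτ : ∀ (y : Fin m → N) (z : Fin m ⊕ M),
      Sum.elim y (Sum.elim a j) (τ z) = Sum.elim y j z := by
    rintro y (z | z) <;> rfl
  have hχ : ∀ y : Fin m → N, χ.Realize (Sum.elim y (Sum.elim a j)) ↔
      θ.Realize (Sum.elim a (Sum.elim y j ∘ t)) ∧
        ¬ d.Realize (Sum.elim (Sum.elim y j ∘ t) (j ∘ Subtype.val)) := by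
    intro y
    rw [Formula.realize_inf, Formula.realize_not]
    refine and_congr (realize_relabel_of_comp ?_) (not_congr (realize_relabel_of_comp ?_))
    · rintro (z | z)
      exacts [rfl, hτ y (t z)]
    · rintro (z | z)
      exacts [hτ y (t z), rfl]
  obtain ⟨d', -, h1, h2⟩ := exists_global_definition hM hA' hi' hq χ
  obtain ⟨b', hb'⟩ := h2 N j a ((h1 N j b a hba).1 ((hχ b).2 ⟨hθ, hnd⟩))
  -- Finite satisfiability of the extension of `q` replaces `b` by `b'` in `M`: now `θ(a, b')`
  -- holds, although the definition puts `θ(x, b')` outside `p = tp(a/M)`.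
  obtain ⟨h3, h4⟩ := (hχ _).1 hb'
  have hc : Sum.elim (j ∘ b') j ∘ t = j ∘ (Sum.elim b' id ∘ t) := by
    ext i
    simp only [Function.comp_apply]
    rcases t i with y | y <;> rfl
  rw [hc] at h3 h4
  rw [realize_map, ← hd] at h4
  exact h4 ((ha k θ _).2 h3)

theorem exists_common_base (hM : IsMonster L M κ) {p : GlobalType L M α}
    (hgs : GenericallyStable κ p) (hsr : StronglyRegular κ p) :
    ∃ A : Set M, #A < κ ∧ InvariantOver p A ∧ StableSequences p A ∧
      ∃ (k : ℕ) (φ : L.Formula (α ⊕ Fin k)) (c : Fin k → M), RegularOver κ p A φ c := by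
  obtain ⟨-, A, hA, hi, hp⟩ := hgs
  obtain ⟨k, φ, c, -, A', hA', -, -, hφ, hr⟩ := hsr
  exact ⟨A ∪ A', hM.small_union hA hA', hi.mono Set.subset_union_left,
    StableSequences.mono hp Set.subset_union_left, k, φ, c,
    RegularOver.mono Set.subset_union_right ⟨hφ, hr⟩⟩

end RudinKeisler

end GlobalRK

/-! ### The theorem. -/

theorem mainTheorem3 {L : FirstOrder.Language.{u, u}} {M : Type u} [L.Structure M]
    (κ : Cardinal.{u}) (hM : IsMonster L M κ) {n : ℕ} (p : GlobalType L M (Fin n))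
    (hgs : GenericallyStable κ p) (hsr : StronglyRegular κ p) :
    RKMinimal p ∧
    (∀ (m : ℕ) (q : GlobalType L M (Fin m)), ¬ Orthogonal p q ↔ RKLe p q) ∧
    (∀ (m : ℕ) (q : GlobalType L M (Fin m)), GenericallyStable κ q → StronglyRegular κ q →
      (¬ Orthogonal p q → StrongRKEquiv p q) ∧
      ∀ (N : Type u) [L.Structure N] (j : M ↪ₑ[L] N) (a : Fin n → N) (b : Fin m → N),
        Realizes j p a → Realizes j q b → ¬ RealizesOver j κ p b a →
        ¬ RealizesOver j κ q a b ∧ SemiIsolatedBy j b a ∧ SemiIsolatedBy j a b) := by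
  obtain ⟨A, hA, hi, hp, k, φ, c, hr⟩ := exists_common_base hM hgs hsr
  have : Nonempty M := hgs.1.nonempty
  refine ⟨⟨hgs.1, fun m q hq => ?_⟩, fun m q => ⟨fun h => ?_, RKLe.not_orthogonal hgs.1⟩,
    fun m q hgs' hsr' => ?_⟩
  · rintro ⟨N, _, j, b, a, hb, ha, hba⟩
    -- The same pair witnesses both directions: `a` semi-isolates `b`, hence depends on it, hence is
    -- semi-isolated by it.
    exact ⟨N, _, j, a, b, ha, hb, semiIsolatedBy_of_not_realizesOver hM hA hi hp hr ha
      (not_realizesOver_of_semiIsolatedBy hM hA hi hp hq ha hb hba)⟩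
  · obtain ⟨N, _, j, a, b, ha, hb, hab⟩ :=
      exists_not_realizesOver_of_not_orthogonal hM hA hi hp h
    exact ⟨N, _, j, a, b, ha, hb, semiIsolatedBy_of_not_realizesOver hM hA hi hp hr ha hab⟩
  · obtain ⟨A', hA', hi', hq, k', φ', c', hr'⟩ := exists_common_base hM hgs' hsr'
    have key : ∀ (N : Type u) [L.Structure N] (j : M ↪ₑ[L] N) (a : Fin n → N) (b : Fin m → N),
        Realizes j p a → Realizes j q b → ¬ RealizesOver j κ p b a →
        ¬ RealizesOver j κ q a b ∧ SemiIsolatedBy j b a ∧ SemiIsolatedBy j a b := by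
      intro N _ j a b ha hb hab
      have hba := not_realizesOver_symm hM hA hi hp hA' hi' hq ha hab
      exact ⟨hba, semiIsolatedBy_of_not_realizesOver hM hA' hi' hq hr' hb hba,
        semiIsolatedBy_of_not_realizesOver hM hA hi hp hr ha hab⟩
    refine ⟨fun h => ?_, key⟩
    obtain ⟨N, _, j, a, b, ha, hb, hab⟩ :=
      exists_not_realizesOver_of_not_orthogonal hM hA hi hp h
    obtain ⟨-, h1, h2⟩ := key N j a b ha hb hab
    exact ⟨N, _, j, a, b, ha, hb, h2, h1⟩
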